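/- Let $F=\mathbb F_{2^q}$ ($q\ge 1$), with every element written as $q$ bits through a fixed basis of $F$ over $\mathbb F_2$, and let $\mathbf H\in F^{m\times n}$ be a check matrix whose $j$-th row has $d_j\ge 3$ nonzero entries. **The matrix $\mathbf A$ and the vector $\mathbf b$.** Enumerate the symbols of check equation $j$ as $u_1,\dots,u_{d_j}$, with coefficients $h_1,\dots,h_{d_j}$. Introduce auxiliary symbols $g_1,\dots,g_{d_j-3}$ and replace the equation by $d_j-2$ three-variables equations over $F$: $h_1u_1+h_2u_2+g_1=0$; $g_{t-1}+h_{t+1}u_{t+1}+g_t=0$ for $2\le t\le d_j-3$; and $g_{d_j-3}+h_{d_j-1}u_{d_j-1}+h_{d_j}u_{d_j}=0$ (if $d_j=3$, the equation is kept). Put $\Gamma_c=\sum_j(d_j-2)$ and $\Gamma_a=\sum_j(d_j-3)$. Encode each of the $n+\Gamma_a$ symbols $u$ by a vector indexed by the nonzero $a\in F$, with entry $1$ at $a=u$ and $0$ elsewhere, and let $\mathbf v=[\mathbf x;\mathbf s]\in\mathbb R^N$, $N=(2^q-1)(n+\Gamma_a)$, collect these vectors for the code symbols ($\mathbf x$)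 and the auxiliary symbols ($\mathbf s$). The constraints $\mathbf A\mathbf v\preceq\mathbf b$, with $M=4(2^q-1)\Gamma_c+n+\Gamma_a$ rows, are the following. For every three-variables equation $h_1u_1+h_2u_2+h_3u_3=0$ and every nonzero $\ell\in F$: $c_1\le c_2+c_3$, $c_2\le c_1+c_3$, $c_3\le c_1+c_2$, $c_1+c_2+c_3\le 2$, where $c_k=\sum_{a\ne 0}\langle \ell,h_ka\rangle\, v_{u_k,a}$ and $\langle\cdot,\cdot\rangle\in\{0,1\}$ is the modulo-2 inner product of the bit vectors. For every symbol $u$: $\sum_{a\neq 0} v_{u,a}\le 1$. **The problem.** Let $\boldsymbol\lambda=[\boldsymbol\gamma;\mathbf 0]\in\mathbb R^N$ with an arbitrary cost vector $\boldsymbol\gamma\in\mathbb R^{n(2^q-1)}$, let $g(\mathbf v)=\boldsymbol\lambda^T\mathbf v-\frac{\alpha}{2}\|\mathbf v-0.5\|_2^2$ and $X=\{\mathbf v:\mathbf A\mathbf v\preceq\mathbf b,\ \mathbf 0\preceq\mathbf v\preceq\mathbf 1\}$. The relaxed nonconvex quadratic program is $\min_{\mathbf v\in X} g(\mathbf v)$.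 Its augmented Lagrangian is $$\mathcal L_\mu(\mathbf v,\mathbf e_1,\mathbf e_2,\mathbf y_1,\mathbf y_2)=g(\mathbf v)+\mathbf y_1^T(\mathbf A\mathbf v+\mathbf e_1-\mathbf b)+\mathbf y_2^T(\mathbf v-\mathbf e_2)+\tfrac{\mu}{2}\|\mathbf A\mathbf v+\mathbf e_1-\mathbf b\|_2^2+\tfrac{\mu}{2}\|\mathbf v-\mathbf e_2\|_2^2 .$$ **The algorithm.** Starting from all-zeros vectors, the proximal-ADMM decoder with step $\beta\in(0,1]$ computes $$\mathbf v^{k+1}=\arg\min_{\mathbf v}\mathcal L_\mu(\mathbf v,\mathbf e_1^k,\mathbf e_2^k,\mathbf y_1^k,\mathbf y_2^k)+\tfrac{\rho}{2}\|\mathbf v-\mathbf p^k\|_2^2,$$ $$\mathbf e_1^{k+1}=\arg\min_{\mathbf e_1\succeq\mathbf 0}\mathcal L_\mu(\mathbf v^{k+1},\mathbf e_1,\mathbf e_2^k,\mathbf y_1^k,\mathbf y_2^k)+\tfrac{\rho}{2}\|\mathbf e_1-\mathbf z_1^k\|_2^2,$$ $$\mathbf e_2^{k+1}=\arg\min_{\mathbf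 0\preceq\mathbf e_2\preceq\mathbf 1}\mathcal L_\mu(\mathbf v^{k+1},\mathbf e_1^k,\mathbf e_2,\mathbf y_1^k,\mathbf y_2^k)+\tfrac{\rho}{2}\|\mathbf e_2-\mathbf z_2^k\|_2^2,$$ $\mathbf p^{k+1}=\mathbf p^k+\beta(\mathbf v^{k+1}-\mathbf p^k)$, $\mathbf z_i^{k+1}=\mathbf z_i^k+\beta(\mathbf e_i^{k+1}-\mathbf z_i^k)$ for $i=1,2$, $\mathbf y_1^{k+1}=\mathbf y_1^k+\mu(\mathbf A\mathbf v^{k+1}+\mathbf e_1^{k+1}-\mathbf b)$, $\mathbf y_2^{k+1}=\mathbf y_2^k+\mu(\mathbf v^{k+1}-\mathbf e_2^{k+1})$. **Theorem.** Let $\delta_{\mathbf A}$ and $\delta_{\mathbf A\mathbf I}$ be the spectral norms of $\mathbf A$ and of $\begin{bmatrix}\mathbf A&\mathbf I_M&\mathbf 0\\ \mathbf I_N&\mathbf 0&-\mathbf I_N\end{bmatrix}$, and let $\lambda_{\min}(\mathbf A^T\mathbf A)>0$ be the smallest eigenvalue of $\mathbf A^T\mathbf A$. Assume $\rho>\alpha>0$,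 $L\ge\alpha+\mu+\mu\delta_{\mathbf A}^2$ and $$\frac{\alpha}{\lambda_{\min}(\mathbf A^T\mathbf A)}\le\mu\le\frac{\rho(\rho-\alpha)^2}{4\delta_{\mathbf A\mathbf I}^2(\rho+L+2)^2-(\rho-\alpha)^2}.$$ Then there is $\beta_0>0$, depending only on the data above, such that for every $\beta\in(0,1]$ with $\beta<\beta_0$ the sequence $(\mathbf v^k,\mathbf e_1^k,\mathbf e_2^k,\mathbf p^k,\mathbf z_1^k,\mathbf z_2^k,\mathbf y_1^k,\mathbf y_2^k)$ generated by the decoder converges to some $(\mathbf v^*,\mathbf e_1^*,\mathbf e_2^*,\mathbf p^*,\mathbf z_1^*,\mathbf z_2^*,\mathbf y_1^*,\mathbf y_2^*)$ with $$\mathbf A\mathbf v^*+\mathbf e_1^*=\mathbf b,\quad \mathbf v^*=\mathbf e_2^*,\quad \mathbf v^*=\mathbf p^*,\quad \mathbf e_1^*=\mathbf z_1^*,\quad \mathbf e_2^*=\mathbf z_2^* .$$ Moreover $\mathbf v^*$ is a stationary point of the quadratic program: $\mathbf v^*\in X$ and $(\mathbf v-\mathbf v^*)^T\nabla g(\mathbf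 v^*)\ge 0$ for all $\mathbf v\in X$. -/

import Mathlib

open Filter Topology

noncomputable section

namespace NonbinaryDecoder

/-! ### The linear code and its decomposition into three-variables check equations -/

/-- A check matrix `H` over `F`, every row of which involves `deg j ≥ 3` symbols, together with
an enumeration `enum j` of the symbols (nonzero entries) of each row. -/
structure CheckData (F : Type*) [Zero F] (m n : ℕ) where
  H : Matrix (Fin m) (Fin n) F
  deg : Fin m → ℕ
  three_le_deg : ∀ j, 3 ≤ deg j
  enum : ∀ j, Fin (deg j) ≃ {i : Fin n // H j i ≠ 0}

/-- The nonzero elements of the field; they index the `2 ^ q - 1` bits that encode one symbol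
(the bit with index `u` is `1` exactly when the symbol equals `u`; the zero symbol has all bits
zero). -/
abbrev Nonzero (F : Type*) [Zero F] : Type _ := {a : F // a ≠ 0}

variable {F : Type*} {m n q : ℕ}

section Decomposition

variable [Zero F]

/-- The auxiliary symbols: `deg j - 3` for the `j`-th check equation. -/
abbrev CheckData.Aux (C : CheckData F m n) : Type := Σ j : Fin m, Fin (C.deg j - 3)

/-- All symbols: the `n` code symbols, followed by the auxiliary ones. -/
abbrev CheckData.Symbol (C : CheckData F m n) : Type := Fin n ⊕ C.Aux

/-- The three-variables check equations: `deg j - 2` for the `j`-th check equation. -/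
abbrev CheckData.Check (C : CheckData F m n) : Type := Σ j : Fin m, Fin (C.deg j - 2)

/-- The `i`-th code symbol of the `j`-th check equation, with its coefficient. -/
def CheckData.codeTerm [One F] (C : CheckData F m n) (j : Fin m) (i : Fin (C.deg j)) :
    C.Symbol × F :=
  (Sum.inl (C.enum j i).1, C.H j (C.enum j i).1)

/-- The three terms (symbol, coefficient) of a three-variables check equation. With the terms of
the `j`-th check equation numbered from `0` to `d - 1`, and its auxiliary symbols `g` numbered from
`0` to `d - 4`, the three-variables equations are
`h₀ u₀ + h₁ u₁ + g₀ = 0`, then `g_{t-1} + h_{t+1} u_{t+1} + g_t = 0` for `0 < t < d - 3`, and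
`g_{d-4} + h_{d-2} u_{d-2} + h_{d-1} u_{d-1} = 0`; for `d = 3` the only equation is
the original one. -/
def CheckData.term [One F] (C : CheckData F m n) (τ : C.Check) : Fin 3 → C.Symbol × F :=
  ![if h : τ.2.1 = 0 then C.codeTerm τ.1 ⟨0, by have := C.three_le_deg τ.1; omega⟩
      else (Sum.inr ⟨τ.1, ⟨τ.2.1 - 1, by have := τ.2.2; omega⟩⟩, 1),
    C.codeTerm τ.1 ⟨τ.2.1 + 1, by have := τ.2.2; omega⟩,
    if h : τ.2.1 + 3 = C.deg τ.1 then C.codeTerm τ.1 ⟨τ.2.1 + 2, by omega⟩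
      else (Sum.inr ⟨τ.1, ⟨τ.2.1, by have := τ.2.2; omega⟩⟩, 1)]

/-- The variable-selecting matrix of a three-variables check equation. -/
def CheckData.Q [One F] (C : CheckData F m n) (τ : C.Check) : Matrix (Fin 3) C.Symbol ℝ :=
  Matrix.of fun k w => if (C.term τ k).1 = w then 1 else 0

end Decomposition

/-! ### The matrix `A` and the vectors `b` and `lam` of the relaxed quadratic program -/

/-- The matrix of the inequalities describing `c₁ + c₂ + c₃ = 0 (mod 2)` for bits. -/
def P : Matrix (Fin 4) (Fin 3) ℝ :=
  !![1, -1, -1; -1, 1, -1; -1, -1, 1; 1, 1, 1]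

/-- The right-hand side belonging to `P`. -/
def t : Fin 4 → ℝ := ![0, 0, 0, 2]

section Construction

variable [Field F] [Fintype F] [DecidableEq F] [Algebra (ZMod 2) F]

/-- The matrix whose column `a` is the binary representation of `a`; the basis `bits` of `F` over
`𝔽₂` fixes how elements of `F` are written as `q` bits. -/
def B (bits : Module.Basis (Fin q) (ZMod 2) F) : Matrix (Fin q) (Nonzero F) (ZMod 2) :=
  Matrix.of fun i a => bits.repr a.1 i

/-- The `{0,1}`-valued matrix `Bᵀ B` reduced modulo `2`: row `l` is the modulo-`2` sum of those
rows of `B` that are selected by the binary representation of `l`. -/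
def rowSums (bits : Module.Basis (Fin q) (ZMod 2) F) : Matrix (Nonzero F) (Nonzero F) ℝ :=
  Matrix.of fun l a => ((((B bits).transpose * B bits) l a).val : ℝ)

/-- `diag(r, r, r)` with `r` the `l`-th row of `rowSums`. -/
def T (bits : Module.Basis (Fin q) (ZMod 2) F) (l : Nonzero F) :
    Matrix (Fin 3) (Fin 3 × Nonzero F) ℝ :=
  Matrix.of fun k c => if c.1 = k then rowSums bits l c.2 else 0

/-- `diag(D(h₁), D(h₂), D(h₃))`, where `D(h)` has entry `1` at `(a, a')` if `a = a' h`, and `0`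
otherwise. -/
def D (h : Fin 3 → F) : Matrix (Fin 3 × Nonzero F) (Fin 3 × Nonzero F) ℝ :=
  Matrix.of fun c c' => if c.1 = c'.1 ∧ c.2.1 = c'.2.1 * h c.1 then 1 else 0

/-- The `4 (2 ^ q - 1)` inequality rows of one three-variables check equation with coefficients
`h`. The reduction modulo `2` is applied to the sums of rows of `B`, not to the signs of `P`. -/
def What (bits : Module.Basis (Fin q) (ZMod 2) F) (h : Fin 3 → F) :
    Matrix (Nonzero F × Fin 4) (Fin 3 × Nonzero F) ℝ :=
  Matrix.of fun r c => (P * T bits r.1 * D h) r.2 c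

/-- Index set of the `N = (2 ^ q - 1) (n + Γₐ)` coordinates of `v = [x; s]`. -/
abbrev CheckData.Col (C : CheckData F m n) : Type _ := C.Symbol × Nonzero F

/-- Index set of the `M = 4 (2 ^ q - 1) Γ_c + n + Γₐ` inequality constraints. -/
abbrev CheckData.Row (C : CheckData F m n) : Type _ := (C.Check × Nonzero F × Fin 4) ⊕ C.Symbol

/-- The rows `∑ a, v (w, a)`, one for each symbol `w`. -/
def CheckData.S (C : CheckData F m n) : Matrix C.Symbol C.Col ℝ :=
  Matrix.of fun w c => if c.1 = w then 1 else 0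

/-- The rows `Ŵ_τ (Q_τ ⊗ I)`, stacked over all three-variables check equations `τ`. -/
def CheckData.checkRows (C : CheckData F m n) (bits : Module.Basis (Fin q) (ZMod 2) F) :
    Matrix (C.Check × Nonzero F × Fin 4) C.Col ℝ :=
  Matrix.of fun r c =>
    (What bits (fun k => (C.term r.1 k).2) *
      Matrix.kronecker (C.Q r.1) (1 : Matrix (Nonzero F) (Nonzero F) ℝ)) r.2 c

/-- The constraint matrix `A`. -/
def CheckData.A (C : CheckData F m n) (bits : Module.Basis (Fin q) (ZMod 2) F) :
    Matrix C.Row C.Col ℝ :=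
  Matrix.fromRows (C.checkRows bits) C.S

/-- The constraint right-hand side `b`. -/
def CheckData.b (C : CheckData F m n) : EuclideanSpace ℝ C.Row :=
  WithLp.toLp 2 (Sum.elim (fun r => t r.2.2) (fun _ => 1))

/-- The linear cost `[γ; 0]`: the cost vector `γ` on the code symbols, zero on auxiliary ones. -/
def CheckData.lam (C : CheckData F m n) (γ : Fin n × Nonzero F → ℝ) : EuclideanSpace ℝ C.Col :=
  WithLp.toLp 2 fun c => Sum.elim (fun i => γ (i, c.2)) (fun _ => 0) c.1

end Construction

/-! ### Spectral quantities -/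

section Spectral

/-- The spectral norm of a real matrix. -/
def specNorm {R N : Type*} [Fintype R] [Fintype N] [DecidableEq N] (A : Matrix R N ℝ) : ℝ :=
  ‖(Matrix.toEuclideanLin A).toContinuousLinearMap‖

/-- The smallest eigenvalue of `Aᵀ A`. -/
def lamMin {R N : Type*} [Fintype R] [Fintype N] [DecidableEq N] (A : Matrix R N ℝ) : ℝ :=
  sInf (spectrum ℝ (A.transpose * A))

/-- The spectral norm of the block matrix `[A I 0; I 0 -I]`. -/
def specNormAI {R N : Type*} [Fintype R] [Fintype N] [DecidableEq R] [DecidableEq N]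
    (A : Matrix R N ℝ) : ℝ :=
  specNorm (Matrix.fromBlocks A (Matrix.fromCols 1 0) 1 (Matrix.fromCols 0 (-1)) :
    Matrix (R ⊕ N) (N ⊕ (R ⊕ N)) ℝ)

end Spectral

/-! ### The quadratic program and the proximal ADMM iteration -/

section ADMM

variable {R N : Type*} [Fintype R] [Fintype N] [DecidableEq N]

/-- The objective `g(v) = lamᵀ v - (α / 2) ‖v - 0.5‖²`. -/
def objective (lam : EuclideanSpace ℝ N) (α : ℝ) (v : EuclideanSpace ℝ N) : ℝ :=
  inner ℝ lam v - α / 2 * ‖v - WithLp.toLp 2 (fun _ => (1 / 2 : ℝ))‖ ^ 2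

/-- The feasible set `X = {v | A v ≤ b, 0 ≤ v ≤ 1}`. -/
def feasible (A : Matrix R N ℝ) (b : EuclideanSpace ℝ R) : Set (EuclideanSpace ℝ N) :=
  {v | (∀ i, Matrix.toEuclideanLin A v i ≤ b i) ∧ ∀ j, 0 ≤ v j ∧ v j ≤ 1}

/-- The augmented Lagrangian. -/
def augLagrangian (A : Matrix R N ℝ) (b : EuclideanSpace ℝ R) (lam : EuclideanSpace ℝ N)
    (α μ : ℝ) (v : EuclideanSpace ℝ N) (e₁ : EuclideanSpace ℝ R) (e₂ : EuclideanSpace ℝ N)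
    (y₁ : EuclideanSpace ℝ R) (y₂ : EuclideanSpace ℝ N) : ℝ :=
  objective lam α v + inner ℝ y₁ (Matrix.toEuclideanLin A v + e₁ - b) + inner ℝ y₂ (v - e₂)
    + μ / 2 * ‖Matrix.toEuclideanLin A v + e₁ - b‖ ^ 2 + μ / 2 * ‖v - e₂‖ ^ 2

/-- The nonnegative orthant. -/
def orthant (R : Type*) : Set (EuclideanSpace ℝ R) := {e | ∀ i, 0 ≤ e i}

/-- The unit box. -/
def unitBox (N : Type*) : Set (EuclideanSpace ℝ N) := {e | ∀ j, 0 ≤ e j ∧ e j ≤ 1}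

/-- The tuple of variables of the iteration. -/
structure State (R N : Type*) where
  v : EuclideanSpace ℝ N
  e₁ : EuclideanSpace ℝ R
  e₂ : EuclideanSpace ℝ N
  p : EuclideanSpace ℝ N
  z₁ : EuclideanSpace ℝ R
  z₂ : EuclideanSpace ℝ N
  y₁ : EuclideanSpace ℝ R
  y₂ : EuclideanSpace ℝ N

/-- One iteration of proximal ADMM leads from the tuple `s` to the tuple `s'`. -/
structure IsStep (A : Matrix R N ℝ) (b : EuclideanSpace ℝ R) (lam : EuclideanSpace ℝ N)
    (α μ ρ β : ℝ) (s s' : State R N) : Prop where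
  v_min : IsMinOn (fun v => augLagrangian A b lam α μ v s.e₁ s.e₂ s.y₁ s.y₂
    + ρ / 2 * ‖v - s.p‖ ^ 2) Set.univ s'.v
  e₁_mem : s'.e₁ ∈ orthant R
  e₁_min : IsMinOn (fun e => augLagrangian A b lam α μ s'.v e s.e₂ s.y₁ s.y₂
    + ρ / 2 * ‖e - s.z₁‖ ^ 2) (orthant R) s'.e₁
  e₂_mem : s'.e₂ ∈ unitBox N
  e₂_min : IsMinOn (fun e => augLagrangian A b lam α μ s'.v s.e₁ e s.y₁ s.y₂
    + ρ / 2 * ‖e - s.z₂‖ ^ 2) (unitBox N) s'.e₂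
  p_eq : s'.p = s.p + β • (s'.v - s.p)
  z₁_eq : s'.z₁ = s.z₁ + β • (s'.e₁ - s.z₁)
  z₂_eq : s'.z₂ = s.z₂ + β • (s'.e₂ - s.z₂)
  y₁_eq : s'.y₁ = s.y₁ + μ • (Matrix.toEuclideanLin A s'.v + s'.e₁ - b)
  y₂_eq : s'.y₂ = s.y₂ + μ • (s'.v - s'.e₂)

/-- `s` is the sequence of tuples generated by proximal ADMM from the all-zeros tuple. -/
def IsProxADMM (A : Matrix R N ℝ) (b : EuclideanSpace ℝ R) (lam : EuclideanSpace ℝ N)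
    (α μ ρ β : ℝ) (s : ℕ → State R N) : Prop :=
  s 0 = ⟨0, 0, 0, 0, 0, 0, 0, 0⟩ ∧ ∀ k, IsStep A b lam α μ ρ β (s k) (s (k + 1))

/-- All eight components of the sequence `s` converge to those of `w`. -/
def ConvergesTo (s : ℕ → State R N) (w : State R N) : Prop :=
  Tendsto (fun k => (s k).v) atTop (𝓝 w.v) ∧
  Tendsto (fun k => (s k).e₁) atTop (𝓝 w.e₁) ∧
  Tendsto (fun k => (s k).e₂) atTop (𝓝 w.e₂) ∧
  Tendsto (fun k => (s k).p) atTop (𝓝 w.p) ∧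
  Tendsto (fun k => (s k).z₁) atTop (𝓝 w.z₁) ∧
  Tendsto (fun k => (s k).z₂) atTop (𝓝 w.z₂) ∧
  Tendsto (fun k => (s k).y₁) atTop (𝓝 w.y₁) ∧
  Tendsto (fun k => (s k).y₂) atTop (𝓝 w.y₂)

/-- `v` is a stationary point, in the variational-inequality sense, of minimizing `objective` over
`feasible`. -/
def IsStationaryPoint (A : Matrix R N ℝ) (b : EuclideanSpace ℝ R) (lam : EuclideanSpace ℝ N) (α : ℝ)
    (v : EuclideanSpace ℝ N) : Prop :=
  v ∈ feasible A b ∧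
    ∀ v' ∈ feasible A b, 0 ≤ inner ℝ (v' - v) (gradient (objective lam α) v)

end ADMM

end NonbinaryDecoder

end

open NonbinaryDecoder

/-! With `K v = (A v, v)`, `a = (b - e₁, e₂)` and `ζ = (b - z₁, z₂)`, the decoder is ADMM for
minimizing `cost v` subject to `K v = a`, `a ∈ C`, where `C` is a polyhedron, with proximal terms
centred at the slowly moving pair `(p, ζ)`. For frozen centres the regularized program is strongly
convex because `α < ρ`, and one ADMM step shrinks `gap`, the squared distance to its primal-dual
solutions (`Step.gap_le`). Moving the centres by relaxation lowers the optimal value `env` of the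
regularized program (`env_relaxed_le`), but also displaces these solutions.

The displacement is harmless for small `β` because all constraints are linear. Hoffman's bound
(`exists_hoffman`) makes solutions and dual sets Lipschitz in the centres (`sol_lipschitz`,
`exists_dual_lipschitz`), and yields an error bound of the gap by the length of the step
(`exists_gap_le_disp_sq`). Hence the potential `env + gap` drops by a multiple of `s`, the sum of
`offset` (squared distance from the centres to the regularized solution) and the squared
displacement (`exists_potential_decrease`).

Summable `s` alone would not give convergence of the iterates. A quadratic has at most one
stationary value on each face of a polyhedron, and near-stationary points attain it up to a
quadratic error (`exists_stationary_value`). There are finitely many faces, so the excess of the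
potential over its limit is eventually at most a multiple of `s`, a Łojasiewicz inequality of
exponent 1/2. Then `√s` is summable (`summable_sqrt_of_decrease`), the iterates are Cauchy, and the
optimality conditions of the steps pass to the limit. -/

namespace PolyhedralADMM

/-! ### Hoffman's error bound for polyhedra. -/

section Hoffman

variable {E F ι : Type*} [NormedAddCommGroup E] [InnerProductSpace ℝ E]
  [NormedAddCommGroup F] [NormedSpace ℝ F]

theorem isClosed_polyhedron (f : ι → E →L[ℝ] ℝ) (c : ι → ℝ) : IsClosed {x | ∀ i, f i x ≤ c i} := by
  simp only [Set.ofPred_forall]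
  exact isClosed_iInter fun i => isClosed_le (f i).continuous continuous_const

variable [FiniteDimensional ℝ E]

/-- Compactness of the unit sphere gives a minimizer of `‖L d‖`. The minimum cannot be zero, since
then `h = d` would be admissible in the polarity condition and give `‖d‖ ^ 2 ≤ 0`. -/
theorem exists_pos_le_norm_of_normal (f : ι → E →L[ℝ] ℝ) (L : E →L[ℝ] F) (I : Finset ι) :
    ∃ δ : ℝ, 0 < δ ∧ ∀ d : E, ‖d‖ = 1 → (∀ i ∈ I, f i d ≤ 0) →
      (∀ h : E, L h = 0 → (∀ i ∈ I, f i h ≤ 0) → inner ℝ d h ≤ 0) → δ ≤ ‖L d‖ := by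
  set S : Set E := Metric.sphere 0 1 ∩ ({d | ∀ i ∈ I, f i d ≤ 0} ∩
    {d | ∀ h : E, L h = 0 → (∀ i ∈ I, f i h ≤ 0) → inner ℝ d h ≤ 0}) with hS
  have hcl : IsClosed ({d : E | ∀ i ∈ I, f i d ≤ 0} ∩
      {d : E | ∀ h : E, L h = 0 → (∀ i ∈ I, f i h ≤ 0) → inner ℝ d h ≤ 0}) := by
    refine IsClosed.inter ?_ ?_
    · simp only [Set.ofPred_forall]
      exact isClosed_iInter fun i => isClosed_iInter fun _ =>
        isClosed_le (f i).continuous continuous_const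
    · simp only [Set.ofPred_forall]
      exact isClosed_iInter fun h => isClosed_iInter fun _ => isClosed_iInter fun _ =>
        isClosed_le (by fun_prop) continuous_const
  have hc : IsCompact S := (isCompact_sphere (0 : E) 1).inter_right hcl
  rcases S.eq_empty_or_nonempty with he | hne
  · refine ⟨1, one_pos, fun d h1 h2 h3 => ?_⟩
    have : d ∈ S := ⟨by simpa using h1, h2, h3⟩
    simp [he] at this
  · obtain ⟨d, hd, hmin⟩ := hc.exists_isMinOn hne (f := fun d => ‖L d‖) (by fun_prop)
    refine ⟨‖L d‖, ?_, fun x h1 h2 h3 => hmin ⟨by simpa using h1, h2, h3⟩⟩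
    rw [norm_pos_iff]
    intro h0
    have h1 : ‖d‖ = 1 := by simpa using hd.1
    have := hd.2.2 d h0 hd.2.1
    rw [real_inner_self_eq_norm_sq, h1] at this
    norm_num at this

variable [Fintype ι]

/-- Hoffman's bound: on a polyhedron, the fibres of a linear map depend on the base point in a
Lipschitz way. The constant does not depend on the right-hand side `c`. -/
theorem exists_hoffman (f : ι → E →L[ℝ] ℝ) (L : E →L[ℝ] F) :
    ∃ κ : ℝ, 0 ≤ κ ∧ ∀ (c : ι → ℝ) (x x₀ : E), (∀ i, f i x ≤ c i) → (∀ i, f i x₀ ≤ c i) →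
      ∃ x', (∀ i, f i x' ≤ c i) ∧ L x' = L x₀ ∧ ‖x - x'‖ ≤ κ * ‖L x - L x₀‖ := by
  choose δ hδ hδ' using exists_pos_le_norm_of_normal f L
  -- The point `x` and the right-hand side enter only through the active set at the projection, and
  -- there are finitely many such sets; hence a uniform constant.
  obtain ⟨ε, hε, hεδ⟩ : ∃ ε : ℝ, 0 < ε ∧ ∀ I, ε ≤ δ I := by
    obtain ⟨I, -, hI⟩ := Finset.exists_min_image (Finset.univ : Finset (Finset ι)) δ ⟨∅, by simp⟩
    exact ⟨δ I, hδ I, fun J => hI J (by simp)⟩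
  refine ⟨ε⁻¹, by positivity, fun c x x₀ hx hx₀ => ?_⟩
  set S : Set E := {y | (∀ i, f i y ≤ c i) ∧ L y = L x₀} with hS
  have hcl : IsClosed S :=
    (isClosed_polyhedron f c).inter (isClosed_eq L.continuous continuous_const)
  obtain ⟨x', hx', hdist⟩ := hcl.exists_infDist_eq_dist ⟨x₀, hx₀, rfl⟩ x
  refine ⟨x', hx'.1, hx'.2, ?_⟩
  rcases eq_or_ne x x' with rfl | hne
  · simp only [sub_self, norm_zero]; positivity
  have hr : 0 < ‖x - x'‖ := norm_pos_iff.2 (sub_ne_zero.2 hne)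
  classical
  -- With `x'` the projection of `x` to the fibre, the direction `x - x'` does not increase the
  -- constraints active at `x'`, and it is polar to every feasible direction `h` in the kernel of
  -- `L`: otherwise a short move along `h` would come closer to `x`.
  set I : Finset ι := Finset.univ.filter fun i => f i x' = c i with hI
  have key := hδ' I (‖x - x'‖⁻¹ • (x - x')) (by
    rw [norm_smul, norm_inv, norm_norm, inv_mul_cancel₀ hr.ne']) (fun i hi => by
      have hi' : f i x' = c i := by simpa [hI] using hi
      have := hx i
      rw [map_smul, map_sub, smul_eq_mul]
      exact mul_nonpos_of_nonneg_of_nonpos (by positivity) (by linarith))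
    (fun h hLh hfh => by
      rw [real_inner_smul_left]
      refine mul_nonpos_of_nonneg_of_nonpos (by positivity) ?_
      by_contra! hpos
      have hev : ∀ᶠ t : ℝ in 𝓝[>] 0, ∀ i, f i (x' + t • h) ≤ c i := by
        refine eventually_all.2 fun i => ?_
        by_cases hi : f i x' = c i
        · filter_upwards [self_mem_nhdsWithin] with t ht
          have := hfh i (by simpa [hI] using hi)
          rw [map_add, map_smul, smul_eq_mul, hi]
          nlinarith [Set.mem_Ioi.1 ht]
        · have hlt : f i x' < c i := lt_of_le_of_ne (hx'.1 i) hi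
          have hcont : Continuous fun t : ℝ => f i (x' + t • h) := by fun_prop
          have := hcont.tendsto 0
          simp only [zero_smul, add_zero] at this
          exact ((this.eventually_lt_const hlt).filter_mono nhdsWithin_le_nhds).mono
            fun t ht => ht.le
      have hev2 : ∀ᶠ t : ℝ in 𝓝[>] 0, t * ‖h‖ ^ 2 < 2 * inner ℝ (x - x') h := by
        have hcont : Continuous fun t : ℝ => t * ‖h‖ ^ 2 := by fun_prop
        have := hcont.tendsto 0
        simp only [zero_mul] at this
        exact (this.eventually_lt_const (by linarith)).filter_mono nhdsWithin_le_nhds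
      obtain ⟨t, ⟨ht1, ht2⟩, ht0⟩ := ((hev.and hev2).and self_mem_nhdsWithin).exists
      have ht0 : 0 < t := ht0
      have hmem : x' + t • h ∈ S := ⟨ht1, by simp [hLh, hx'.2]⟩
      have hle := Metric.infDist_le_dist_of_mem (x := x) hmem
      rw [hdist, dist_eq_norm, dist_eq_norm, show x - (x' + t • h) = (x - x') - t • h by abel]
        at hle
      have hsq := pow_le_pow_left₀ (norm_nonneg _) hle 2
      rw [norm_sub_sq_real (x - x'), inner_smul_right, norm_smul, mul_pow, Real.norm_eq_abs,
        sq_abs] at hsq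
      nlinarith)
  rw [map_smul, norm_smul, norm_inv, norm_norm, map_sub, hx'.2] at key
  have h2 := (hεδ I).trans key
  rw [← div_eq_inv_mul, le_div_iff₀ hr] at h2
  rw [← div_eq_inv_mul, le_div_iff₀ hε]
  linarith

/-- The linear image of a polyhedron is closed. -/
theorem isClosed_image_polyhedron (f : ι → E →L[ℝ] ℝ) (L : E →L[ℝ] F) (c : ι → ℝ) :
    IsClosed (L '' {x | ∀ i, f i x ≤ c i}) := by
  obtain ⟨κ, hκ, h⟩ := exists_hoffman f L
  refine isClosed_of_closure_subset fun y hy => ?_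
  obtain ⟨_, x₀, hx₀, rfl⟩ := closure_nonempty_iff.1 ⟨y, hy⟩
  -- Hoffman's bound replaces preimages of points within distance 1 of `y` by preimages in this ball
  -- around `x₀`, and the image of a compact set is closed.
  set R := κ * (‖L x₀ - y‖ + 1)
  have hcomp : IsCompact (L '' ({x | ∀ i, f i x ≤ c i} ∩ Metric.closedBall x₀ R)) :=
    ((isCompact_closedBall x₀ R).inter_left (isClosed_polyhedron f c)).image L.continuous
  have hy' : y ∈ closure (L '' ({x | ∀ i, f i x ≤ c i} ∩ Metric.closedBall x₀ R)) := by
    rw [Metric.mem_closure_iff] at hy ⊢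
    intro ε hε
    obtain ⟨_, ⟨x₁, hx₁, rfl⟩, hd⟩ := hy (min ε 1) (by positivity)
    obtain ⟨x', hx', hL, hn⟩ := h c x₀ x₁ hx₀ hx₁
    refine ⟨L x', ⟨x', ⟨hx', ?_⟩, rfl⟩, by rw [hL]; exact hd.trans_le (min_le_left _ _)⟩
    rw [mem_closedBall_iff_norm']
    refine hn.trans (mul_le_mul_of_nonneg_left ?_ hκ)
    have h1 : ‖L x₀ - L x₁‖ ≤ ‖L x₀ - y‖ + ‖y - L x₁‖ := norm_sub_le_norm_sub_add_norm_sub _ _ _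
    have h2 : ‖y - L x₁‖ < 1 := by rw [← dist_eq_norm]; exact hd.trans_le (min_le_right _ _)
    linarith
  rw [hcomp.isClosed.closure_eq] at hy'
  exact Set.image_mono Set.inter_subset_left hy'

end Hoffman

/-! ### Farkas' lemma, multipliers and their Lipschitz dependence. -/

section Duality

variable {E W ι : Type*} [NormedAddCommGroup E] [InnerProductSpace ℝ E]
  [NormedAddCommGroup W] [InnerProductSpace ℝ W]

/-- The polyhedron `{x | ∀ i, ⟪n i, x⟫ ≤ c i}`. -/
def poly (n : ι → E) (c : ι → ℝ) : Set E := {x | ∀ i, inner ℝ (n i) x ≤ c i}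

/-- The vectors that are maximized over `S` at `a`. -/
def NormalAt (S : Set E) (a η : E) : Prop := ∀ x ∈ S, inner ℝ η x ≤ inner ℝ η a

variable [Fintype ι]

/-- The pair `(∑ θᵢ nᵢ, ∑ θᵢ cᵢ)`, linear in the multipliers `θ`. -/
noncomputable def combine (n : ι → E) (c : ι → ℝ) : EuclideanSpace ℝ ι →L[ℝ] E × ℝ :=
  ∑ i, (EuclideanSpace.proj i : EuclideanSpace ℝ ι →L[ℝ] ℝ).smulRight (n i, c i)

theorem combine_fst (n : ι → E) (c : ι → ℝ) (θ : EuclideanSpace ℝ ι) :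
    (combine n c θ).1 = ∑ i, θ i • n i := by
  simp [combine, Prod.fst_sum]

theorem combine_snd (n : ι → E) (c : ι → ℝ) (θ : EuclideanSpace ℝ ι) :
    (combine n c θ).2 = ∑ i, θ i * c i := by
  simp [combine, Prod.snd_sum]

theorem inner_le_of_multiplier {n : ι → E} {c : ι → ℝ} {θ : ι → ℝ} (hθ : ∀ i, 0 ≤ θ i) {x : E}
    (hx : x ∈ poly n c) : inner ℝ (∑ i, θ i • n i) x ≤ ∑ i, θ i * c i := by
  rw [sum_inner]
  refine Finset.sum_le_sum fun i _ => ?_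
  rw [real_inner_smul_left]
  exact mul_le_mul_of_nonneg_left (hx i) (hθ i)

variable [FiniteDimensional ℝ E] [FiniteDimensional ℝ W]

omit [Fintype ι] in
-- Farkas' lemma. The cone generated by the pairs `(n i, c i)` is closed, being a linear image of an
-- orthant, so a point outside is separated from it by a functional of the form `(d, τ)`, which
-- violates `h`.
theorem exists_nonneg_combine_eq {κ : Type*} [Fintype κ] (n : κ → E) (c : κ → ℝ) (x : E × ℝ)
    (h : ∀ (d : E) (τ : ℝ), (∀ i, 0 ≤ inner ℝ d (n i) + τ * c i) →
      0 ≤ inner ℝ d x.1 + τ * x.2) :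
    ∃ θ : EuclideanSpace ℝ κ, (∀ i, 0 ≤ θ i) ∧ combine n c θ = x := by
  classical
  set Pos : Set (EuclideanSpace ℝ κ) :=
    {θ | ∀ i, (-(EuclideanSpace.proj i : EuclideanSpace ℝ κ →L[ℝ] ℝ)) θ ≤ 0} with hPos
  have hmem : ∀ θ : EuclideanSpace ℝ κ, θ ∈ Pos ↔ ∀ i, 0 ≤ θ i := fun θ => by simp [hPos]
  have hcl : IsClosed (combine n c '' Pos) := isClosed_image_polyhedron _ (combine n c) fun _ => 0
  have hconv : Convex ℝ (combine n c '' Pos) := by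
    refine Convex.is_linear_image ?_ (combine n c).isBoundedLinearMap.toIsLinearMap
    intro θ hθ θ' hθ' s t hs ht _
    rw [hmem] at hθ hθ' ⊢
    intro i
    have := hθ i
    have := hθ' i
    simp only [PiLp.add_apply, PiLp.smul_apply, smul_eq_mul]
    positivity
  by_contra! hcon
  have hx : x ∉ combine n c '' Pos := by
    rintro ⟨θ, hθ, rfl⟩
    exact hcon θ ((hmem θ).1 hθ) rfl
  obtain ⟨f, u, hfx, hfu⟩ := geometric_hahn_banach_point_closed hconv hcl hx
  have hu : u < 0 := by
    have := hfu 0 ⟨0, (hmem 0).2 (by simp), by simp⟩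
    simpa using this
  have hnonneg : ∀ θ ∈ Pos, 0 ≤ f (combine n c θ) := by
    intro θ hθ
    by_contra! hneg
    have h1 := hfu (combine n c ((u / f (combine n c θ)) • θ)) ⟨_, (hmem _).2 fun i => by
      have := (hmem θ).1 hθ i
      have : 0 ≤ u / f (combine n c θ) := (div_pos_of_neg_of_neg hu hneg).le
      simp only [PiLp.smul_apply, smul_eq_mul]
      positivity, rfl⟩
    rw [map_smul, map_smul, smul_eq_mul, div_mul_cancel₀ _ hneg.ne] at h1
    exact lt_irrefl _ h1
  set d : E := (InnerProductSpace.toDual ℝ E).symm (f.comp (ContinuousLinearMap.inl ℝ E ℝ)) with hd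
  have hf : ∀ y : E × ℝ, f y = inner ℝ d y.1 + f (0, 1) * y.2 := by
    intro y
    have h1 : inner ℝ d y.1 = f (y.1, 0) := by simp [hd]
    have h2 : f (0, 1) * y.2 = f (0, y.2) := by
      rw [mul_comm, ← smul_eq_mul, ← map_smul]; simp
    rw [h1, h2, ← map_add]; simp
  have := h d (f (0, 1)) fun i => by
    have h1 := hnonneg (EuclideanSpace.single i 1) ((hmem _).2 fun j => by
      by_cases hj : j = i <;> simp [hj])
    rw [hf, combine_fst, combine_snd] at h1
    simpa [Pi.single_apply, Finset.sum_ite_eq', ite_smul] using h1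
  rw [← hf] at this
  linarith

/-- Linear programming duality: existence of Lagrange multipliers at a maximizer. -/
theorem exists_multiplier (n : ι → E) (c : ι → ℝ) {x w : E} (hx : x ∈ poly n c)
    (hw : NormalAt (poly n c) x w) :
    ∃ θ : EuclideanSpace ℝ ι, (∀ i, 0 ≤ θ i) ∧ combine n c θ = (w, inner ℝ w x) := by
  -- The extra generator `(0, 1)`, indexed by `none`, represents the slack in the bound on the
  -- right-hand side.
  obtain ⟨θ, hθ, hθx⟩ := exists_nonneg_combine_eq (κ := Option ι)
    (fun i => i.elim 0 n) (fun i => i.elim 1 c) (w, inner ℝ w x) (by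
      intro d τ h
      have hτ : 0 ≤ τ := by simpa using h none
      have hi : ∀ i, 0 ≤ inner ℝ d (n i) + τ * c i := fun i => by simpa using h (some i)
      -- This point is feasible, and using `1 + τ` instead of `τ` covers `τ = 0` without a separate
      -- case.
      have h1 := hw ((1 + τ)⁻¹ • (x - d)) fun i => by
        rw [inner_smul_right, inner_sub_right, ← div_eq_inv_mul, div_le_iff₀ (by linarith)]
        have := hx i
        have := hi i
        rw [real_inner_comm] at this
        nlinarith
      rw [inner_smul_right, inner_sub_right, ← div_eq_inv_mul, div_le_iff₀ (by linarith)] at h1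
      rw [real_inner_comm]
      dsimp only
      linarith)
  refine ⟨WithLp.toLp 2 fun i => θ (some i), fun i => hθ _, ?_⟩
  have h1 := congrArg Prod.fst hθx
  have h2 := congrArg Prod.snd hθx
  rw [combine_fst, Fintype.sum_option] at h1
  rw [combine_snd, Fintype.sum_option] at h2
  simp only [Option.elim_none, Option.elim_some, smul_zero, zero_add, mul_one] at h1 h2
  -- Weak duality leaves no room for the slack, so its multiplier vanishes.
  have h3 := inner_le_of_multiplier (θ := fun i => θ (some i)) (fun i => hθ _) hx
  rw [h1] at h3
  have h0 := hθ none
  refine Prod.ext ?_ ?_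
  · rw [combine_fst]; exact h1
  · rw [combine_snd]; dsimp only; linarith

/-- The set of multipliers `η` of a linear program `max {⟪w, v⟫ | K v ∈ poly n c}` depends on the
cost vector `w` in a Lipschitz way, and this extends to multipliers of infeasible points. -/
theorem exists_multiplier_near (K : E →L[ℝ] W) (n : ι → W) (c : ι → ℝ) {R : ℝ}
    (hR : ∀ v, K v ∈ poly n c → ‖v‖ ≤ R) :
    ∃ κ : ℝ, 0 ≤ κ ∧ ∀ (η a : W) (w v : E), a ∈ poly n c → NormalAt (poly n c) a η →
      K v ∈ poly n c → NormalAt (K ⁻¹' poly n c) v w →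
      ∃ η', K.adjoint η' = w ∧ NormalAt (poly n c) (K v) η' ∧
        ‖η - η'‖ ≤ κ * (‖K.adjoint η - w‖ + inner ℝ η (a - K v)) := by
  -- Hoffman's bound on the orthant of coefficients `θ`: optimality of a multiplier amounts to
  -- prescribing `combine` there, because equality of the primal and dual values is complementary
  -- slackness.
  obtain ⟨κ, hκ, hoff⟩ := exists_hoffman
    (fun i => -(EuclideanSpace.proj i : EuclideanSpace ℝ ι →L[ℝ] ℝ))
    (combine (fun i => K.adjoint (n i)) c)
  set J : EuclideanSpace ℝ ι →L[ℝ] W := (ContinuousLinearMap.fst ℝ W ℝ).comp (combine n c) with hJ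
  have hJ' : ∀ θ, J θ = (combine n c θ).1 := fun θ => rfl
  have hX : K ⁻¹' poly n c = poly (fun i => K.adjoint (n i)) c := by
    ext v; simp [poly, ContinuousLinearMap.adjoint_inner_left]
  have hcomb : ∀ θ, combine (fun i => K.adjoint (n i)) c θ
      = (K.adjoint (combine n c θ).1, (combine n c θ).2) := fun θ => by
    refine Prod.ext ?_ ?_
    · simp [combine_fst]
    · simp [combine_snd]
  refine ⟨‖J‖ * κ * (2 + |R|), by positivity, fun η a w v ha hη hv hw => ?_⟩
  obtain ⟨θ, hθ, hθη⟩ := exists_multiplier n c ha hη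
  obtain ⟨θ₀, hθ₀, hθw⟩ := exists_multiplier (fun i => K.adjoint (n i)) c (x := v) (w := w)
    (by rw [← hX]; exact hv) (by rw [← hX]; exact hw)
  obtain ⟨θ', hθ', heq, hle⟩ := hoff (fun _ => 0) θ θ₀ (fun i => by simpa using hθ i)
    (fun i => by simpa using hθ₀ i)
  rw [hθw, hcomb] at heq hle
  rw [hθη] at hle
  replace hθ' : ∀ i, 0 ≤ θ' i := fun i => by simpa using hθ' i
  have h1 : K.adjoint (combine n c θ').1 = w := congrArg Prod.fst heq
  have h2 : (combine n c θ').2 = inner ℝ w v := congrArg Prod.snd heq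
  refine ⟨J θ', h1, fun x hx => ?_, ?_⟩
  · rw [hJ', ← ContinuousLinearMap.adjoint_inner_left, h1, ← h2, combine_fst, combine_snd]
    exact inner_le_of_multiplier hθ' hx
  · have hη0 : η = J θ := by rw [hJ', hθη]
    have hpos : 0 ≤ inner ℝ η (a - K v) := by
      rw [inner_sub_right]; linarith [hη _ hv]
    -- The mismatch of the values splits into the complementarity defect and an error in the cost
    -- vector, the latter bounded because feasible points are.
    have hdiff : inner ℝ η a - inner ℝ w v
        = inner ℝ η (a - K v) + inner ℝ (K.adjoint η - w) v := by
      rw [inner_sub_right, inner_sub_left, ContinuousLinearMap.adjoint_inner_left]; ring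
    have hcs : |inner ℝ (K.adjoint η - w) v| ≤ ‖K.adjoint η - w‖ * |R| :=
      (abs_real_inner_le_norm _ _).trans
        (mul_le_mul_of_nonneg_left ((hR v hv).trans (le_abs_self R)) (norm_nonneg _))
    have hnorm : ‖((K.adjoint η, inner ℝ η a) : E × ℝ) - (w, inner ℝ w v)‖
        ≤ (2 + |R|) * (‖K.adjoint η - w‖ + inner ℝ η (a - K v)) := by
      rw [Prod.mk_sub_mk, Prod.norm_mk, hdiff, Real.norm_eq_abs]
      have := abs_add_le (inner ℝ η (a - K v)) (inner ℝ (K.adjoint η - w) v)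
      rw [abs_of_nonneg hpos] at this
      have h3 := mul_nonneg (abs_nonneg R) hpos
      have h4 := norm_nonneg (K.adjoint η - w)
      have h5 := mul_nonneg (abs_nonneg R) h4
      refine max_le (by nlinarith) (by nlinarith)
    calc ‖η - J θ'‖ = ‖J (θ - θ')‖ := by rw [hη0, map_sub]
      _ ≤ ‖J‖ * ‖θ - θ'‖ := J.le_opNorm _
      _ ≤ ‖J‖ * (κ * ((2 + |R|) * (‖K.adjoint η - w‖ + inner ℝ η (a - K v)))) := by
          gcongr
          exact hle.trans (mul_le_mul_of_nonneg_left hnorm hκ)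
      _ = _ := by ring

end Duality

/-! ### The proximally regularized program and its dual solutions. -/

theorem nonneg_of_forall_small {B Q : ℝ} (h : ∀ t : ℝ, 0 < t → t ≤ 1 → 0 ≤ t * B + t ^ 2 * Q) :
    0 ≤ B := by
  have hcont : Continuous fun t : ℝ => B + t * Q := by fun_prop
  have h1 : Tendsto (fun t : ℝ => B + t * Q) (𝓝[>] 0) (𝓝 B) := by
    have := hcont.tendsto 0
    simp only [zero_mul, add_zero] at this
    exact this.mono_left nhdsWithin_le_nhds
  refine ge_of_tendsto h1 ?_
  filter_upwards [Ioc_mem_nhdsGT one_pos] with t ht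
  have := h t ht.1 ht.2
  have h2 : 0 ≤ t * (B + t * Q) := by linarith [show t * (B + t * Q) = t * B + t ^ 2 * Q by ring]
  exact nonneg_of_mul_nonneg_right h2 ht.1

theorem norm_add_smul_sq {E : Type*} [NormedAddCommGroup E] [InnerProductSpace ℝ E] (x d : E)
    (t : ℝ) : ‖x + t • d‖ ^ 2 = ‖x‖ ^ 2 + 2 * t * inner ℝ x d + t ^ 2 * ‖d‖ ^ 2 := by
  rw [norm_add_sq_real, inner_smul_right, norm_smul, mul_pow, Real.norm_eq_abs, sq_abs]; ring

/-- The data of the program `min ⟪l, v⟫ - α / 2 ‖v‖ ^ 2` subject to `K v ∈ poly n c`, with a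
nonempty bounded feasible set, together with the parameters of the proximal ADMM. -/
structure Program (E W ι : Type*) [NormedAddCommGroup E] [InnerProductSpace ℝ E]
    [NormedAddCommGroup W] [InnerProductSpace ℝ W] where
  K : E →L[ℝ] W
  n : ι → W
  c : ι → ℝ
  l : E
  α : ℝ
  μ : ℝ
  ρ : ℝ
  R : ℝ
  α_pos : 0 < α
  μ_pos : 0 < μ
  α_lt_ρ : α < ρ
  exists_feasible : ∃ v, K v ∈ poly n c
  norm_le : ∀ v, K v ∈ poly n c → ‖v‖ ≤ R

namespace Program

variable {E W ι : Type*} [NormedAddCommGroup E] [InnerProductSpace ℝ E]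
  [NormedAddCommGroup W] [InnerProductSpace ℝ W] (D : Program E W ι)

theorem ρ_pos : 0 < D.ρ := D.α_pos.trans D.α_lt_ρ

/-- The polyhedron of admissible values of `K v`. -/
abbrev C : Set W := poly D.n D.c

/-- The feasible set. -/
abbrev X : Set E := D.K ⁻¹' D.C

/-- The objective. -/
noncomputable def cost (v : E) : ℝ := inner ℝ D.l v - D.α / 2 * ‖v‖ ^ 2

/-- The gradient of the objective. -/
def grad (v : E) : E := D.l - D.α • v

/-- The proximally regularized objective. -/
noncomputable def prox (p : E) (ζ : W) (v : E) : ℝ :=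
  D.cost v + D.ρ / 2 * ‖v - p‖ ^ 2 + D.ρ / 2 * ‖D.K v - ζ‖ ^ 2

theorem isClosed_C : IsClosed D.C := isClosed_polyhedron (fun i => innerSL ℝ (D.n i)) D.c

theorem isClosed_X : IsClosed D.X := D.isClosed_C.preimage D.K.continuous

theorem cost_add_smul (v d : E) (t : ℝ) :
    D.cost (v + t • d) = D.cost v + t * inner ℝ (D.grad v) d + t ^ 2 * (-D.α / 2 * ‖d‖ ^ 2) := by
  simp only [cost, grad, norm_add_smul_sq, inner_add_right, inner_smul_right, inner_sub_left,
    real_inner_smul_left]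
  ring

theorem prox_add_smul (p : E) (ζ : W) (v d : E) (t : ℝ) :
    D.prox p ζ (v + t • d) = D.prox p ζ v
      + t * (inner ℝ (D.grad v + D.ρ • (v - p)) d + D.ρ * inner ℝ (D.K v - ζ) (D.K d))
      + t ^ 2 * ((D.ρ - D.α) / 2 * ‖d‖ ^ 2 + D.ρ / 2 * ‖D.K d‖ ^ 2) := by
  have h1 : v + t • d - p = (v - p) + t • d := by abel
  have h2 : D.K (v + t • d) - ζ = (D.K v - ζ) + t • D.K d := by
    rw [map_add, map_smul]; abel
  simp only [prox, cost_add_smul, h1, h2, norm_add_smul_sq, inner_add_left, real_inner_smul_left]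
  ring

theorem convex_C : Convex ℝ D.C := by
  intro x hx y hy s t hs ht hst i
  rw [inner_add_right, inner_smul_right, inner_smul_right]
  calc s * inner ℝ (D.n i) x + t * inner ℝ (D.n i) y ≤ s * D.c i + t * D.c i := by
        gcongr
        · exact hx i
        · exact hy i
    _ = D.c i := by rw [← add_mul, hst, one_mul]

theorem continuous_cost : Continuous D.cost := by unfold cost; fun_prop

theorem add_smul_mem_X {v x : E} (hv : v ∈ D.X) (hx : x ∈ D.X) {t : ℝ} (ht : 0 < t) (ht1 : t ≤ 1) :
    v + t • (x - v) ∈ D.X := by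
  have := (D.convex_C.linear_preimage D.K.toLinearMap).add_smul_sub_mem hv hx (t := t) ⟨ht.le, ht1⟩
  exact this

variable [FiniteDimensional ℝ E]

theorem isCompact_X : IsCompact D.X :=
  (isCompact_closedBall (0 : E) D.R).of_isClosed_subset D.isClosed_X
    fun v hv => by simpa using D.norm_le v hv

theorem exists_sol (p : E) (ζ : W) : ∃ v ∈ D.X, ∀ x ∈ D.X, D.prox p ζ v ≤ D.prox p ζ x := by
  obtain ⟨v, hv, hmin⟩ := D.isCompact_X.exists_isMinOn D.exists_feasible (f := D.prox p ζ)
    (by unfold prox; have := D.continuous_cost; fun_prop)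
  exact ⟨v, hv, fun x hx => hmin hx⟩

/-- The minimizer of the proximally regularized objective over the feasible set. -/
noncomputable def sol (p : E) (ζ : W) : E := (D.exists_sol p ζ).choose

theorem sol_mem (p : E) (ζ : W) : D.K (D.sol p ζ) ∈ D.C := (D.exists_sol p ζ).choose_spec.1

theorem prox_sol_le (p : E) (ζ : W) {x : E} (hx : D.K x ∈ D.C) :
    D.prox p ζ (D.sol p ζ) ≤ D.prox p ζ x := (D.exists_sol p ζ).choose_spec.2 x hx

variable [FiniteDimensional ℝ W]

/-- The image `K†η` of the multipliers `η` at the minimizer. -/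
noncomputable def force (p : E) (ζ : W) : E :=
  -(D.grad (D.sol p ζ) + D.ρ • (D.sol p ζ - p)) - D.ρ • D.K.adjoint (D.K (D.sol p ζ) - ζ)

theorem inner_force (p : E) (ζ : W) (d : E) : inner ℝ (D.force p ζ) d =
    -(inner ℝ (D.grad (D.sol p ζ) + D.ρ • (D.sol p ζ - p)) d
      + D.ρ * inner ℝ (D.K (D.sol p ζ) - ζ) (D.K d)) := by
  rw [force, inner_sub_left, inner_neg_left, real_inner_smul_left,
    ContinuousLinearMap.adjoint_inner_left]
  ring

theorem normalAt_force (p : E) (ζ : W) : NormalAt D.X (D.sol p ζ) (D.force p ζ) := by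
  intro x hx
  have h := nonneg_of_forall_small
    (B := -inner ℝ (D.force p ζ) (x - D.sol p ζ))
    (Q := (D.ρ - D.α) / 2 * ‖x - D.sol p ζ‖ ^ 2 + D.ρ / 2 * ‖D.K (x - D.sol p ζ)‖ ^ 2)
    fun t ht ht1 => by
      have := D.prox_sol_le p ζ (D.add_smul_mem_X (D.sol_mem p ζ) hx ht ht1)
      rw [prox_add_smul] at this
      rw [inner_force]
      linarith
  rw [inner_sub_right] at h
  linarith

/-- The dual solutions of the proximally regularized program. -/
def dualSet (p : E) (ζ : W) : Set W :=
  {y | D.K.adjoint y = -(D.grad (D.sol p ζ) + D.ρ • (D.sol p ζ - p)) ∧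
    NormalAt D.C (D.K (D.sol p ζ)) (y - D.ρ • (D.K (D.sol p ζ) - ζ))}

theorem isClosed_dualSet (p : E) (ζ : W) : IsClosed (D.dualSet p ζ) := by
  refine IsClosed.inter (isClosed_eq (by fun_prop) continuous_const) ?_
  change IsClosed {y | ∀ x ∈ D.C, inner ℝ (y - D.ρ • (D.K (D.sol p ζ) - ζ)) x
    ≤ inner ℝ (y - D.ρ • (D.K (D.sol p ζ) - ζ)) (D.K (D.sol p ζ))}
  simp only [Set.ofPred_forall]
  exact isClosed_iInter fun x => isClosed_iInter fun _ => isClosed_le (by fun_prop) (by fun_prop)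

/-- In the split problem the proximal term centred at `ζ` belongs to the block `a`. Passing from a
multiplier of `K v ∈ C` to one of the coupling `K v = a` therefore shifts it by `ρ (K v - ζ)`. -/
theorem add_mem_dualSet {p : E} {ζ η : W} (h1 : D.K.adjoint η = D.force p ζ)
    (h2 : NormalAt D.C (D.K (D.sol p ζ)) η) :
    η + D.ρ • (D.K (D.sol p ζ) - ζ) ∈ D.dualSet p ζ := by
  refine ⟨?_, by rwa [add_sub_cancel_right]⟩
  rw [map_add, map_smul, h1, force]; abel

theorem adjoint_sub_of_mem_dualSet {p : E} {ζ y : W} (h : y ∈ D.dualSet p ζ) :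
    D.K.adjoint (y - D.ρ • (D.K (D.sol p ζ) - ζ)) = D.force p ζ := by
  rw [map_sub, map_smul, h.1, force]

theorem inner_force_sub (p p' : E) (ζ ζ' : W) :
    0 ≤ inner ℝ (D.force p' ζ' - D.force p ζ) (D.sol p' ζ' - D.sol p ζ) := by
  have h1 := D.normalAt_force p ζ _ (D.sol_mem p' ζ')
  have h2 := D.normalAt_force p' ζ' _ (D.sol_mem p ζ)
  simp only [inner_sub_left, inner_sub_right]
  linarith

/-- Strong monotonicity: the normals at two solutions are monotone, while the regularized gradient
has modulus `ρ - α` in `v` and `ρ` in `K v`. The factor 2 comes from `(x + y) ^ 2 ≤ 2 (x ^ 2 + y ^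
2)`. -/
theorem sol_lipschitz (p p' : E) (ζ ζ' : W) :
    ‖D.sol p' ζ' - D.sol p ζ‖ + ‖D.K (D.sol p' ζ') - D.K (D.sol p ζ)‖
      ≤ 2 * D.ρ / (D.ρ - D.α) * (‖p' - p‖ + ‖ζ' - ζ‖) := by
  have h := D.inner_force_sub p p' ζ ζ'
  have hpos : 0 < D.ρ - D.α := sub_pos.2 D.α_lt_ρ
  set d := D.sol p' ζ' - D.sol p ζ with hd
  have hK : D.K (D.sol p' ζ') - D.K (D.sol p ζ) = D.K d := by rw [hd, map_sub]
  rw [hK]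
  have e1 : inner ℝ (D.force p' ζ' - D.force p ζ) d
      = -((D.ρ - D.α) * ‖d‖ ^ 2 + D.ρ * ‖D.K d‖ ^ 2)
        + D.ρ * inner ℝ (p' - p) d + D.ρ * inner ℝ (ζ' - ζ) (D.K d) := by
    rw [inner_sub_left, inner_force, inner_force]
    have : D.sol p' ζ' = D.sol p ζ + d := by rw [hd]; abel
    rw [this]
    simp only [grad, map_add, inner_add_left, inner_sub_left, real_inner_smul_left, smul_add,
      real_inner_self_eq_norm_sq]
    ring
  rw [e1] at h
  have c1 := mul_le_mul_of_nonneg_left (real_inner_le_norm (p' - p) d) D.ρ_pos.le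
  have c2 := mul_le_mul_of_nonneg_left (real_inner_le_norm (ζ' - ζ) (D.K d)) D.ρ_pos.le
  rw [div_mul_eq_mul_div, le_div_iff₀ hpos]
  have n1 := norm_nonneg d
  have n2 := norm_nonneg (D.K d)
  have n3 := norm_nonneg (p' - p)
  have n4 := norm_nonneg (ζ' - ζ)
  have hα := D.α_pos
  have hρ := D.ρ_pos
  generalize ‖d‖ = x at *
  generalize ‖D.K d‖ = y at *
  generalize ‖p' - p‖ = r at *
  generalize ‖ζ' - ζ‖ = s at *
  rcases (add_nonneg n1 n2).eq_or_lt with h0 | h0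
  · rw [← h0, zero_mul]; positivity
  · have h3 : (x + y) * (D.ρ - D.α) * (x + y) ≤ 2 * D.ρ * (r + s) * (x + y) := by
      have t1 : (D.ρ - D.α) * (x + y) ^ 2 ≤ (D.ρ - D.α) * (2 * (x ^ 2 + y ^ 2)) :=
        mul_le_mul_of_nonneg_left (by nlinarith [sq_nonneg (x - y)]) hpos.le
      have t2 : D.α * y ^ 2 ≥ 0 := by positivity
      have t3 : 0 ≤ D.ρ * (r * y) := by positivity
      have t4 : 0 ≤ D.ρ * (s * x) := by positivity
      nlinarith
    exact le_of_mul_le_mul_right h3 h0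

end Program
-- One ADMM step: contraction of the gap and error bound.
theorem add_sq_le_young {x k τ : ℝ} (hτ : 0 < τ) :
    (x + k) ^ 2 ≤ (1 + τ) * x ^ 2 + (1 + τ⁻¹) * k ^ 2 := by
  have h : 0 ≤ τ⁻¹ * (τ * x - k) ^ 2 := by positivity
  have : τ⁻¹ * (τ * x - k) ^ 2 = τ * x ^ 2 - 2 * x * k + τ⁻¹ * k ^ 2 := by field_simp; ring
  nlinarith

/-- The energy identity of ADMM. It is applied with `dy = y' - y₀`, `e = a' - a`, `r = K v' - a'`
and `da = a' - K v₀`; then `dy - μ • r` and `da - e` are the errors before the step, and `h` is the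
optimality of `v'` paired with `K (v' - v₀)`. -/
theorem lyapunov_identity {W : Type*} [NormedAddCommGroup W] [InnerProductSpace ℝ W]
    {μ s : ℝ} (hμ : 0 < μ) {dy e r da : W}
    (h : inner ℝ (dy + μ • e) (r + da) = -s) :
    μ⁻¹ * ‖dy - μ • r‖ ^ 2 + μ * ‖da - e‖ ^ 2 = μ⁻¹ * ‖dy‖ ^ 2 + μ * ‖da‖ ^ 2
      + μ * ‖r + e‖ ^ 2 + 2 * s + 2 * inner ℝ dy da := by
  simp only [inner_add_left, inner_add_right, real_inner_smul_left] at h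
  rw [norm_sub_sq_real, norm_sub_sq_real, norm_add_sq_real, inner_smul_right, norm_smul, mul_pow,
    Real.norm_eq_abs, sq_abs, real_inner_comm e r, real_inner_comm e da]
  field_simp
  linear_combination (-2 * μ) * h

namespace Program

variable {E W ι : Type*} [NormedAddCommGroup E] [InnerProductSpace ℝ E]
  [NormedAddCommGroup W] [InnerProductSpace ℝ W] (D : Program E W ι)
  [FiniteDimensional ℝ E] [FiniteDimensional ℝ W]

theorem norm_adjoint_apply_le (x : W) : ‖D.K.adjoint x‖ ≤ ‖D.K‖ * ‖x‖ := by
  have := D.K.adjoint.le_opNorm x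
  rwa [LinearIsometryEquiv.norm_map] at this

theorem exists_force_lipschitz : ∃ κ : ℝ, 0 ≤ κ ∧ ∀ (p p' : E) (ζ ζ' : W),
    ‖D.force p ζ - D.force p' ζ'‖ ≤ κ * (‖p' - p‖ + ‖ζ' - ζ‖) := by
  have hpos : 0 < D.ρ - D.α := sub_pos.2 D.α_lt_ρ
  have hα := D.α_pos
  have hρ := D.ρ_pos
  refine ⟨(D.α + D.ρ) * (2 * D.ρ / (D.ρ - D.α)) + D.ρ
    + D.ρ * ‖D.K‖ * (2 * D.ρ / (D.ρ - D.α) + 1), by positivity, fun p p' ζ ζ' => ?_⟩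
  have hlip := D.sol_lipschitz p p' ζ ζ'
  set d := D.sol p' ζ' - D.sol p ζ with hd
  set d₂ := D.K (D.sol p' ζ') - D.K (D.sol p ζ) with hd₂
  have e : D.force p ζ - D.force p' ζ' = (D.ρ - D.α) • d - D.ρ • (p' - p)
      + D.ρ • D.K.adjoint (d₂ - (ζ' - ζ)) := by
    rw [hd, hd₂]
    simp only [force, grad, map_sub, smul_sub, sub_smul]
    abel
  have b1 : ‖(D.ρ - D.α) • d‖ ≤ (D.α + D.ρ) * ‖d‖ := by
    rw [norm_smul, Real.norm_of_nonneg hpos.le]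
    gcongr; linarith
  have b2 : ‖D.ρ • (p' - p)‖ = D.ρ * ‖p' - p‖ := by rw [norm_smul, Real.norm_of_nonneg hρ.le]
  have b3 : ‖D.ρ • D.K.adjoint (d₂ - (ζ' - ζ))‖ ≤ D.ρ * ‖D.K‖ * (‖d₂‖ + ‖ζ' - ζ‖) := by
    rw [norm_smul, Real.norm_of_nonneg hρ.le, mul_assoc]
    gcongr
    exact (D.norm_adjoint_apply_le _).trans (by gcongr; exact norm_sub_le _ _)
  have b4 : ‖D.force p ζ - D.force p' ζ'‖ ≤ (D.α + D.ρ) * ‖d‖ + D.ρ * ‖p' - p‖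
      + D.ρ * ‖D.K‖ * (‖d₂‖ + ‖ζ' - ζ‖) := by
    rw [e]
    refine (norm_add_le _ _).trans (add_le_add ((norm_sub_le _ _).trans ?_) b3)
    rw [b2]; linarith
  refine b4.trans ?_
  set m := ‖p' - p‖ + ‖ζ' - ζ‖ with hm
  set s := 2 * D.ρ / (D.ρ - D.α) with hs
  have m1 : ‖d‖ ≤ s * m := by linarith [norm_nonneg d₂]
  have m2 : ‖d₂‖ ≤ s * m := by linarith [norm_nonneg d]
  have m3 : ‖p' - p‖ ≤ m := by linarith [norm_nonneg (ζ' - ζ)]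
  have m4 : ‖ζ' - ζ‖ ≤ m := by linarith [norm_nonneg (p' - p)]
  calc _ ≤ (D.α + D.ρ) * (s * m) + D.ρ * m + D.ρ * ‖D.K‖ * (s * m + m) := by gcongr
    _ = _ := by ring

/-- The distance (in the metric of the alternating direction method) from the pair `(a, y)` to the
primal-dual solutions of the regularized program. -/
noncomputable def gap (a y : W) (p : E) (ζ : W) : ℝ :=
  D.μ⁻¹ * Metric.infDist y (D.dualSet p ζ) ^ 2 + D.μ * ‖a - D.K (D.sol p ζ)‖ ^ 2

theorem gap_nonneg (a y : W) (p : E) (ζ : W) : 0 ≤ D.gap a y p ζ := by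
  have := D.μ_pos
  unfold gap; positivity

variable [Fintype ι]

theorem exists_multiplier_near : ∃ κ : ℝ, 0 ≤ κ ∧ ∀ (η a : W) (p : E) (ζ : W), a ∈ D.C →
    NormalAt D.C a η → ∃ y ∈ D.dualSet p ζ, ‖η - (y - D.ρ • (D.K (D.sol p ζ) - ζ))‖
      ≤ κ * (‖D.K.adjoint η - D.force p ζ‖ + inner ℝ η (a - D.K (D.sol p ζ))) := by
  obtain ⟨κ, hκ, h⟩ := PolyhedralADMM.exists_multiplier_near D.K D.n D.c D.norm_le
  refine ⟨κ, hκ, fun η a p ζ ha hη => ?_⟩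
  obtain ⟨η', h1, h2, h3⟩ := h η a _ _ ha hη (D.sol_mem p ζ) (D.normalAt_force p ζ)
  exact ⟨_, D.add_mem_dualSet h1 h2, by rwa [add_sub_cancel_right]⟩

theorem dualSet_nonempty (p : E) (ζ : W) : (D.dualSet p ζ).Nonempty := by
  obtain ⟨κ, -, h⟩ := D.exists_multiplier_near
  obtain ⟨y, hy, -⟩ := h 0 _ p ζ (D.sol_mem p ζ) fun x _ => by simp
  exact ⟨y, hy⟩

theorem exists_nearest_dual (p : E) (ζ y : W) :
    ∃ y₀ ∈ D.dualSet p ζ, Metric.infDist y (D.dualSet p ζ) = ‖y - y₀‖ := by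
  obtain ⟨y₀, h, h'⟩ :=
    (D.isClosed_dualSet p ζ).exists_infDist_eq_dist (D.dualSet_nonempty p ζ) y
  exact ⟨y₀, h, by rw [h', dist_eq_norm]⟩

/-- The dual set may be unbounded, so the estimate is of Hausdorff type. A multiplier for the old
centres is an approximate one for the new centres. Its complementarity defect is linear in the
change because the new force pairs nonpositively with `sol p ζ - sol p' ζ'`, so that only the
difference of the forces counts. -/
theorem exists_dual_lipschitz : ∃ κ : ℝ, 0 ≤ κ ∧ ∀ (p p' : E) (ζ ζ' y : W), y ∈ D.dualSet p ζ →
    ∃ y' ∈ D.dualSet p' ζ', ‖y - y'‖ ≤ κ * (‖p' - p‖ + ‖ζ' - ζ‖) := by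
  obtain ⟨κ₁, hκ₁, h1⟩ := D.exists_multiplier_near
  obtain ⟨κ₂, hκ₂, h2⟩ := D.exists_force_lipschitz
  have hpos : 0 < D.ρ - D.α := sub_pos.2 D.α_lt_ρ
  have hρ := D.ρ_pos
  have hR : 0 ≤ D.R := (norm_nonneg _).trans (D.norm_le _ D.exists_feasible.choose_spec)
  refine ⟨κ₁ * (κ₂ * (1 + 2 * D.R)) + D.ρ * (2 * D.ρ / (D.ρ - D.α) + 1), by positivity,
    fun p p' ζ ζ' y hy => ?_⟩
  obtain ⟨y', hy', hle⟩ := h1 _ _ p' ζ' (D.sol_mem p ζ) hy.2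
  refine ⟨y', hy', ?_⟩
  have hlip := D.sol_lipschitz p p' ζ ζ'
  rw [← map_sub D.K, ← ContinuousLinearMap.adjoint_inner_left,
    D.adjoint_sub_of_mem_dualSet hy] at hle
  set m := ‖p' - p‖ + ‖ζ' - ζ‖ with hm
  have hm0 : 0 ≤ m := by positivity
  have hin : inner ℝ (D.force p ζ) (D.sol p ζ - D.sol p' ζ')
      ≤ ‖D.force p ζ - D.force p' ζ'‖ * (2 * D.R) := by
    have t1 := D.normalAt_force p' ζ' _ (D.sol_mem p ζ)
    have t2 : inner ℝ (D.force p ζ) (D.sol p ζ - D.sol p' ζ')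
        ≤ inner ℝ (D.force p ζ - D.force p' ζ') (D.sol p ζ - D.sol p' ζ') := by
      rw [inner_sub_left, inner_sub_right (D.force p' ζ')]; linarith
    refine t2.trans ((real_inner_le_norm _ _).trans ?_)
    gcongr
    refine (norm_sub_le _ _).trans ?_
    linarith [D.norm_le _ (D.sol_mem p ζ), D.norm_le _ (D.sol_mem p' ζ')]
  have hf := h2 p p' ζ ζ'
  have hη : ‖y - D.ρ • (D.K (D.sol p ζ) - ζ) - (y' - D.ρ • (D.K (D.sol p' ζ') - ζ'))‖
      ≤ κ₁ * (κ₂ * (1 + 2 * D.R)) * m := by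
    refine hle.trans ?_
    calc κ₁ * (‖D.force p ζ - D.force p' ζ'‖ + inner ℝ (D.force p ζ) (D.sol p ζ - D.sol p' ζ'))
        ≤ κ₁ * (κ₂ * m + κ₂ * m * (2 * D.R)) := by
          refine mul_le_mul_of_nonneg_left (add_le_add hf (hin.trans ?_)) hκ₁
          gcongr
      _ = _ := by ring
  have e : y - y' = (y - D.ρ • (D.K (D.sol p ζ) - ζ) - (y' - D.ρ • (D.K (D.sol p' ζ') - ζ')))
      + (D.ρ • (ζ' - ζ) - D.ρ • (D.K (D.sol p' ζ') - D.K (D.sol p ζ))) := by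
    simp only [smul_sub]; abel
  rw [e, add_mul]
  refine (norm_add_le _ _).trans (add_le_add hη ((norm_sub_le _ _).trans ?_))
  rw [norm_smul, norm_smul, Real.norm_of_nonneg hρ.le, ← mul_add, mul_assoc, add_mul]
  refine mul_le_mul_of_nonneg_left ?_ hρ.le
  linarith [norm_nonneg (D.sol p' ζ' - D.sol p ζ), norm_nonneg (p' - p)]

/-- The parameter `τ` stays free so that the factor `1 + τ` can be absorbed later by the decrease in
one step. -/
theorem exists_gap_drift : ∃ κ : ℝ, 0 ≤ κ ∧ ∀ (a y : W) (p p' : E) (ζ ζ' : W) (τ : ℝ), 0 < τ →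
    D.gap a y p' ζ' ≤ (1 + τ) * D.gap a y p ζ
      + (1 + τ⁻¹) * (κ * (‖p' - p‖ + ‖ζ' - ζ‖) ^ 2) := by
  obtain ⟨κ₁, hκ₁, h1⟩ := D.exists_dual_lipschitz
  have hμ := D.μ_pos
  set s := 2 * D.ρ / (D.ρ - D.α) with hs
  refine ⟨D.μ⁻¹ * κ₁ ^ 2 + D.μ * s ^ 2, by positivity, fun a y p p' ζ ζ' τ hτ => ?_⟩
  obtain ⟨y₀, hy₀, hd⟩ := D.exists_nearest_dual p ζ y
  obtain ⟨y₁, hy₁, hle⟩ := h1 p p' ζ ζ' y₀ hy₀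
  have hlip := D.sol_lipschitz p p' ζ ζ'
  rw [← hs] at hlip
  set m := ‖p' - p‖ + ‖ζ' - ζ‖ with hm
  have d1 : Metric.infDist y (D.dualSet p' ζ') ≤ ‖y - y₀‖ + κ₁ * m := by
    refine (Metric.infDist_le_dist_of_mem hy₁).trans ?_
    rw [dist_eq_norm]
    exact (norm_sub_le_norm_sub_add_norm_sub _ y₀ _).trans (by gcongr)
  have d2 : ‖a - D.K (D.sol p' ζ')‖ ≤ ‖a - D.K (D.sol p ζ)‖ + s * m := by
    refine (norm_sub_le_norm_sub_add_norm_sub _ (D.K (D.sol p ζ)) _).trans ?_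
    rw [norm_sub_rev (D.K (D.sol p ζ))]
    gcongr
    linarith [norm_nonneg (D.sol p' ζ' - D.sol p ζ)]
  have s1 := (pow_le_pow_left₀ Metric.infDist_nonneg d1 2).trans (add_sq_le_young hτ)
  have s2 := (pow_le_pow_left₀ (norm_nonneg _) d2 2).trans (add_sq_le_young hτ)
  rw [gap, gap, hd]
  calc _ ≤ D.μ⁻¹ * ((1 + τ) * ‖y - y₀‖ ^ 2 + (1 + τ⁻¹) * (κ₁ * m) ^ 2)
      + D.μ * ((1 + τ) * ‖a - D.K (D.sol p ζ)‖ ^ 2 + (1 + τ⁻¹) * (s * m) ^ 2) := by gcongr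
    _ = _ := by ring

/-- One step of the alternating direction method for the regularized program, in terms of its
optimality conditions. -/
structure Step (p : E) (ζ a y : W) (v' : E) (a' y' : W) : Prop where
  -- By `dual_eq`, `y' + μ (a' - a) = y + μ (K v' - a)`: the minimization in `v` still sees the old
  -- `a`.
  grad_eq : D.grad v' + D.ρ • (v' - p) + D.K.adjoint (y' + D.μ • (a' - a)) = 0
  mem : a' ∈ D.C
  normal : NormalAt D.C a' (y' - D.ρ • (a' - ζ))
  dual_eq : y' = y + D.μ • (D.K v' - a')

variable {D} {p : E} {ζ a y : W} {v' : E} {a' y' : W}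

/-- The amount by which one step decreases the gap. -/
noncomputable def decrease (D : Program E W ι) (p : E) (ζ a : W) (v' : E) (a' : W) : ℝ :=
  D.μ * ‖D.K v' - a‖ ^ 2 + 2 * (D.ρ - D.α) * ‖v' - D.sol p ζ‖ ^ 2
    + 2 * D.ρ * ‖a' - D.K (D.sol p ζ)‖ ^ 2

theorem Step.gap_le (h : D.Step p ζ a y v' a' y') :
    D.gap a' y' p ζ + D.decrease p ζ a v' a' ≤ D.gap a y p ζ := by
  obtain ⟨y₀, hy₀, hd⟩ := D.exists_nearest_dual p ζ y
  have hμ := D.μ_pos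
  have hdist : Metric.infDist y' (D.dualSet p ζ) ≤ ‖y' - y₀‖ := by
    rw [← dist_eq_norm]; exact Metric.infDist_le_dist_of_mem hy₀
  have hsq := mul_le_mul_of_nonneg_left (pow_le_pow_left₀ Metric.infDist_nonneg hdist 2)
    (inv_pos.2 hμ).le
  rw [gap, gap, hd, decrease]
  set v₀ := D.sol p ζ with hv₀
  -- Difference of the stationarity equations in `v` for the step and for the solution. Next comes
  -- monotonicity of the normals of `C`, which is where the proximal term in `a` contributes `ρ`.
  have h1 : inner ℝ (y' - y₀ + D.μ • (a' - a)) (D.K v' - a' + (a' - D.K v₀))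
      = -((D.ρ - D.α) * ‖v' - v₀‖ ^ 2) := by
    have hadj : D.K.adjoint (y' - y₀ + D.μ • (a' - a)) = -((D.ρ - D.α) • (v' - v₀)) := by
      have e1 := h.grad_eq
      have e2 := hy₀.1
      rw [show y' - y₀ + D.μ • (a' - a) = (y' + D.μ • (a' - a)) - y₀ by abel, map_sub, e2,
        eq_neg_of_add_eq_zero_right e1]
      simp only [grad, sub_smul, smul_sub]
      abel
    rw [sub_add_sub_cancel, ← map_sub, ← ContinuousLinearMap.adjoint_inner_left, hadj,
      inner_neg_left, real_inner_smul_left, real_inner_self_eq_norm_sq]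
  have h2 : D.ρ * ‖a' - D.K v₀‖ ^ 2 ≤ inner ℝ (y' - y₀) (a' - D.K v₀) := by
    have e1 := h.normal _ (D.sol_mem p ζ)
    have e2 := hy₀.2 _ h.mem
    rw [← hv₀] at e1 e2
    rw [← real_inner_self_eq_norm_sq]
    simp only [inner_sub_left, inner_sub_right, real_inner_smul_left] at e1 e2 ⊢
    linarith
  have h3 := lyapunov_identity hμ h1
  have e1 : y' - y₀ - D.μ • (D.K v' - a') = y - y₀ := by rw [h.dual_eq]; abel
  have e2 : a' - D.K v₀ - (a' - a) = a - D.K v₀ := by abel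
  have e3 : D.K v' - a' + (a' - a) = D.K v' - a := by abel
  rw [e1, e2, e3] at h3
  linarith

/-- The total displacement of one step. -/
noncomputable def disp (D : Program E W ι) (p : E) (ζ a y : W) (v' : E) (a' y' : W) : ℝ :=
  ‖v' - D.sol p ζ‖ + ‖a' - D.K (D.sol p ζ)‖ + ‖a' - a‖ + ‖y' - y‖

omit [Fintype ι] in
theorem exists_disp_sq_le (D : Program E W ι) : ∃ κ : ℝ, 0 < κ ∧ ∀ (p : E) (ζ a y : W) (v' : E) (a' y' : W),
    D.Step p ζ a y v' a' y' →
    D.disp p ζ a y v' a' y' ^ 2 ≤ κ * D.decrease p ζ a v' a' := by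
  have hpos : 0 < D.ρ - D.α := sub_pos.2 D.α_lt_ρ
  have hμ := D.μ_pos
  have hρ := D.ρ_pos
  set k := 1 + (1 + D.μ) * (‖D.K‖ + 1) with hk
  set m := min D.μ (min (2 * (D.ρ - D.α)) (2 * D.ρ)) with hm
  have hm0 : 0 < m := by positivity
  have hk0 : 0 < k := by positivity
  refine ⟨3 * k ^ 2 / m, by positivity, fun p ζ a y v' a' y' h => ?_⟩
  rw [disp, decrease]
  -- The primal residual is controlled by the errors of `v'` and `a'`; it in turn controls `y' - y`
  -- and, together with `K v' - a`, also `a' - a`.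
  have n1 : ‖D.K v' - a'‖ ≤ ‖D.K‖ * ‖v' - D.sol p ζ‖ + ‖a' - D.K (D.sol p ζ)‖ := by
    rw [show D.K v' - a' = D.K (v' - D.sol p ζ) - (a' - D.K (D.sol p ζ)) by rw [map_sub]; abel]
    exact (norm_sub_le _ _).trans (by gcongr; exact D.K.le_opNorm _)
  have n2 : ‖a' - a‖ ≤ ‖D.K v' - a‖ + ‖D.K v' - a'‖ := by
    rw [show a' - a = (D.K v' - a) - (D.K v' - a') by abel]
    exact norm_sub_le _ _
  have n3 : ‖y' - y‖ = D.μ * ‖D.K v' - a'‖ := by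
    rw [h.dual_eq, add_sub_cancel_left, norm_smul, Real.norm_of_nonneg hμ.le]
  rw [n3]
  have g1 := norm_nonneg (v' - D.sol p ζ)
  have g2 := norm_nonneg (a' - D.K (D.sol p ζ))
  have g3 := norm_nonneg (D.K v' - a)
  have g4 := norm_nonneg (a' - a)
  have g5 := norm_nonneg (D.K v' - a')
  have hKn := norm_nonneg D.K
  have m1 : m ≤ D.μ := min_le_left _ _
  have m2 : m ≤ 2 * (D.ρ - D.α) := (min_le_right _ _).trans (min_le_left _ _)
  have m3 : m ≤ 2 * D.ρ := (min_le_right _ _).trans (min_le_right _ _)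
  generalize ‖v' - D.sol p ζ‖ = x₁ at *
  generalize ‖a' - D.K (D.sol p ζ)‖ = x₂ at *
  generalize ‖D.K v' - a‖ = x₃ at *
  generalize ‖a' - a‖ = x₄ at *
  generalize ‖D.K v' - a'‖ = x₅ at *
  have b1 : x₁ + x₂ + x₄ + D.μ * x₅ ≤ k * (x₁ + x₂ + x₃) := by
    have t1 : (1 + D.μ) * x₅ ≤ (1 + D.μ) * ((‖D.K‖ + 1) * (x₁ + x₂ + x₃)) := by
      refine mul_le_mul_of_nonneg_left (n1.trans ?_) (by positivity)
      have : 0 ≤ ‖D.K‖ * (x₂ + x₃) := by positivity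
      nlinarith
    rw [hk]
    linarith
  have b2 := pow_le_pow_left₀ (by positivity) b1 2
  rw [div_mul_eq_mul_div, le_div_iff₀ hm0]
  have b3 : (x₁ + x₂ + x₃) ^ 2 ≤ 3 * (x₁ ^ 2 + x₂ ^ 2 + x₃ ^ 2) := by
    nlinarith [sq_nonneg (x₁ - x₂), sq_nonneg (x₁ - x₃), sq_nonneg (x₂ - x₃)]
  calc _ ≤ (k * (x₁ + x₂ + x₃)) ^ 2 * m := by gcongr
    _ = k ^ 2 * (x₁ + x₂ + x₃) ^ 2 * m := by ring
    _ ≤ k ^ 2 * (3 * (x₁ ^ 2 + x₂ ^ 2 + x₃ ^ 2)) * m := by gcongr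
    _ = 3 * k ^ 2 * (m * x₃ ^ 2 + m * x₁ ^ 2 + m * x₂ ^ 2) := by ring
    _ ≤ _ := by gcongr

/-- Error bound: after one step the gap is controlled by the displacement, uniformly as long as
the gap is bounded. -/
theorem exists_gap_le_disp_sq (D : Program E W ι) (G : ℝ) : ∃ κ : ℝ, 0 < κ ∧
    ∀ (p : E) (ζ a y : W) (v' : E) (a' y' : W), D.Step p ζ a y v' a' y' → D.gap a y p ζ ≤ G →
      D.gap a' y' p ζ ≤ κ * D.disp p ζ a y v' a' y' ^ 2 := by
  obtain ⟨κ₁, hκ₁, h1⟩ := D.exists_multiplier_near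
  have hpos : 0 < D.ρ - D.α := sub_pos.2 D.α_lt_ρ
  have hμ := D.μ_pos
  have hρ := D.ρ_pos
  -- A bound for the distance from `y'` to the dual set. The complementarity defect below is a
  -- product of this distance and a displacement, so the bound `G` is what makes the estimate
  -- linear.
  set r := Real.sqrt (D.μ * G) with hr
  set k := κ₁ * ((D.ρ - D.α) + ‖D.K‖ * (D.μ + D.ρ) + r) + D.ρ with hk
  have hr0 : 0 ≤ r := Real.sqrt_nonneg _
  have hk0 : 0 ≤ k := by positivity
  refine ⟨D.μ⁻¹ * k ^ 2 + D.μ, by positivity, fun p ζ a y v' a' y' h hG => ?_⟩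
  set e := D.disp p ζ a y v' a' y' with he
  set v₀ := D.sol p ζ with hv₀
  have e0 : e = ‖v' - v₀‖ + ‖a' - D.K v₀‖ + ‖a' - a‖ + ‖y' - y‖ := rfl
  have g1 := norm_nonneg (v' - v₀)
  have g2 := norm_nonneg (a' - D.K v₀)
  have g3 := norm_nonneg (a' - a)
  have g4 := norm_nonneg (y' - y)
  have e1 : ‖v' - v₀‖ ≤ e := by linarith
  have e2 : ‖a' - D.K v₀‖ ≤ e := by linarith
  have e3 : ‖a' - a‖ ≤ e := by linarith
  obtain ⟨y₀, hy₀, hd⟩ := D.exists_nearest_dual p ζ y'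
  obtain ⟨y₁, hy₁, hle⟩ := h1 _ _ p ζ h.mem h.normal
  rw [← hv₀] at hle
  have hyr : ‖y' - y₀‖ ≤ r := by
    refine Real.le_sqrt_of_sq_le ?_
    have t1 := h.gap_le
    have t2 : 0 ≤ D.decrease p ζ a v' a' := by unfold decrease; positivity
    have t3 : D.μ⁻¹ * ‖y' - y₀‖ ^ 2 ≤ D.gap a' y' p ζ := by
      rw [gap, hd]
      have : 0 ≤ D.μ * ‖a' - D.K (D.sol p ζ)‖ ^ 2 := by positivity
      linarith
    rw [inv_mul_eq_div, ] at t3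
    rw [mul_comm, ← div_le_iff₀ hμ]
    linarith
  have hin : inner ℝ (y' - D.ρ • (a' - ζ)) (a' - D.K v₀) ≤ r * e := by
    have t1 := hy₀.2 _ h.mem
    rw [← hv₀] at t1
    -- The terms dropped have a sign: `y₀ - ρ (K v₀ - ζ)` is normal at `K v₀`, and the rest is `-ρ
    -- ‖a' - K v₀‖ ^ 2`.
    have t2 : inner ℝ (y' - D.ρ • (a' - ζ)) (a' - D.K v₀)
        ≤ inner ℝ (y' - y₀) (a' - D.K v₀) := by
      have t3 : 0 ≤ D.ρ * inner ℝ (a' - D.K v₀) (a' - D.K v₀) :=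
        mul_nonneg hρ.le real_inner_self_nonneg
      simp only [inner_sub_left, inner_sub_right, real_inner_smul_left] at t1 t3 ⊢
      linarith
    exact t2.trans ((real_inner_le_norm _ _).trans (by gcongr))
  have hadj : ‖D.K.adjoint (y' - D.ρ • (a' - ζ)) - D.force p ζ‖
      ≤ ((D.ρ - D.α) + ‖D.K‖ * (D.μ + D.ρ)) * e := by
    have t1 : D.K.adjoint (y' - D.ρ • (a' - ζ)) - D.force p ζ
        = -((D.ρ - D.α) • (v' - v₀)) - D.K.adjoint (D.μ • (a' - a) + D.ρ • (a' - D.K v₀)) := by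
      have t2 := h.grad_eq
      have t3 : y' - D.ρ • (a' - ζ) = (y' + D.μ • (a' - a)) - D.μ • (a' - a) - D.ρ • (a' - ζ) := by
        abel
      rw [t3, map_sub, map_sub, eq_neg_of_add_eq_zero_right t2, force, ← hv₀]
      simp only [grad, sub_smul, smul_sub, map_sub, map_add, map_smul]
      abel
    rw [t1]
    refine (norm_sub_le _ _).trans ?_
    rw [norm_neg, norm_smul, Real.norm_of_nonneg hpos.le, add_mul, mul_assoc]
    refine add_le_add (by gcongr) ((D.norm_adjoint_apply_le _).trans ?_)
    gcongr
    refine (norm_add_le _ _).trans ?_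
    rw [norm_smul, norm_smul, Real.norm_of_nonneg hμ.le, Real.norm_of_nonneg hρ.le, add_mul]
    gcongr
  have hdist : Metric.infDist y' (D.dualSet p ζ) ≤ k * e := by
    refine (Metric.infDist_le_dist_of_mem hy₁).trans ?_
    rw [dist_eq_norm, show y' - y₁ = (y' - D.ρ • (a' - ζ) - (y₁ - D.ρ • (D.K v₀ - ζ)))
      + D.ρ • (a' - D.K v₀) by simp only [smul_sub]; abel]
    refine (norm_add_le _ _).trans ?_
    rw [norm_smul, Real.norm_of_nonneg hρ.le, hk, add_mul]
    refine add_le_add (hle.trans ?_) (by gcongr)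
    rw [mul_assoc]
    refine mul_le_mul_of_nonneg_left ?_ hκ₁
    rw [add_mul]
    exact add_le_add hadj hin
  rw [gap, ← hv₀]
  calc _ ≤ D.μ⁻¹ * (k * e) ^ 2 + D.μ * e ^ 2 := by
        gcongr
        exact Metric.infDist_nonneg
    _ = _ := by ring

end Program
-- Moving the centres and decrease of the potential.
theorem norm_sub_relaxed_sq_le {E : Type*} [NormedAddCommGroup E] [InnerProductSpace ℝ E]
    (x p x' : E) {β : ℝ} (h0 : 0 ≤ β) (h1 : β ≤ 1) :
    ‖x - (p + β • (x' - p))‖ ^ 2 ≤ (1 - β) * ‖x - p‖ ^ 2 + β * ‖x' - x‖ ^ 2 := by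
  have e : x - (p + β • (x' - p)) = (x - p) - β • ((x' - x) + (x - p)) := by
    simp only [smul_add, smul_sub]; abel
  generalize x - p = u at *
  generalize x' - x = d at *
  rw [e, show u - β • (d + u) = (1 - β) • u - β • d by simp only [sub_smul, smul_add, one_smul]; abel,
    norm_sub_sq_real, norm_smul, norm_smul, real_inner_smul_left, inner_smul_right,
    Real.norm_of_nonneg h0, Real.norm_of_nonneg (sub_nonneg.2 h1)]
  have h := sq_nonneg ‖u + d‖
  rw [norm_add_sq_real] at h
  nlinarith [mul_nonneg (mul_nonneg h0 (sub_nonneg.2 h1)) h]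

/-- A monotone sequence whose decrements dominate `s k` and which is itself eventually dominated
by `s k` has finite length. -/
theorem summable_sqrt_of_decrease {φ s : ℕ → ℝ} {φ₀ c κ : ℝ} (hc : 0 < c) (hκ : 0 < κ)
    (hs : ∀ k, 0 ≤ s k) (hφ : ∀ k, φ₀ ≤ φ k) (hdec : ∀ k, φ (k + 1) + c * s k ≤ φ k)
    (hle : ∀ᶠ k in atTop, φ k - φ₀ ≤ κ * s k) : Summable fun k => √(s k) := by
  obtain ⟨k₀, hk₀⟩ := eventually_atTop.1 hle
  rw [← summable_nat_add_iff k₀]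
  -- With `x`, `y` the square roots of consecutive excesses and `w = √(s k)`, one has `c w² ≤ (x -
  -- y)(x + y) ≤ 2 √κ w (x - y)`. Dividing by `w` leaves a telescoping bound.
  have hstep : ∀ k, √(s (k + k₀))
      ≤ 2 * √κ / c * (√(φ (k + k₀) - φ₀) - √(φ (k + 1 + k₀) - φ₀)) := by
    intro k
    have h1 := hdec (k + k₀)
    have h2 := hk₀ (k + k₀) (by omega)
    have h3 := hφ (k + k₀)
    have h4 := hφ (k + 1 + k₀)
    rw [show k + k₀ + 1 = k + 1 + k₀ by ring] at h1
    have hw := hs (k + k₀)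
    have hx2 := Real.sq_sqrt (sub_nonneg.2 h3)
    have hy2 := Real.sq_sqrt (sub_nonneg.2 h4)
    have hw2 := Real.sq_sqrt hw
    have hx0 := Real.sqrt_nonneg (φ (k + k₀) - φ₀)
    have hy0 := Real.sqrt_nonneg (φ (k + 1 + k₀) - φ₀)
    have hw0 := Real.sqrt_nonneg (s (k + k₀))
    have hyx : √(φ (k + 1 + k₀) - φ₀) ≤ √(φ (k + k₀) - φ₀) :=
      Real.sqrt_le_sqrt (by nlinarith)
    have hxw : √(φ (k + k₀) - φ₀) ≤ √κ * √(s (k + k₀)) := by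
      rw [← Real.sqrt_mul hκ.le]; exact Real.sqrt_le_sqrt h2
    have hκ0 := Real.sqrt_nonneg κ
    generalize √(φ (k + k₀) - φ₀) = x at *
    generalize √(φ (k + 1 + k₀) - φ₀) = y at *
    generalize √(s (k + k₀)) = w at *
    generalize √κ = r at *
    rw [div_mul_eq_mul_div, le_div_iff₀ hc]
    rcases hw0.eq_or_lt with rfl | hpos
    · rw [zero_mul]; exact mul_nonneg (by positivity) (sub_nonneg.2 hyx)
    · refine le_of_mul_le_mul_right ?_ hpos
      calc w * c * w = c * w ^ 2 := by ring
        _ ≤ (x - y) * (x + y) := by rw [hw2]; nlinarith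
        _ ≤ (x - y) * (2 * (r * w)) :=
            mul_le_mul_of_nonneg_left (by linarith) (sub_nonneg.2 hyx)
        _ = 2 * r * (x - y) * w := by ring
  refine summable_of_sum_range_le (c := 2 * √κ / c * √(φ k₀ - φ₀)) (fun k => Real.sqrt_nonneg _)
    fun N => ?_
  refine (Finset.sum_le_sum fun k _ => hstep k).trans ?_
  rw [← Finset.mul_sum, Finset.sum_range_sub' (fun k => √(φ (k + k₀) - φ₀))]
  refine mul_le_mul_of_nonneg_left ?_ (by positivity)
  rw [zero_add]
  linarith [Real.sqrt_nonneg (φ (N + k₀) - φ₀)]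

namespace Program

variable {E W ι : Type*} [NormedAddCommGroup E] [InnerProductSpace ℝ E]
  [NormedAddCommGroup W] [InnerProductSpace ℝ W] (D : Program E W ι)
  [FiniteDimensional ℝ E]

/-- The minimal value of the proximally regularized objective. -/
noncomputable def env (p : E) (ζ : W) : ℝ := D.prox p ζ (D.sol p ζ)

/-- The squared distance from the proximal center to the solution of the regularized program. -/
noncomputable def offset (p : E) (ζ : W) : ℝ :=
  ‖D.sol p ζ - p‖ ^ 2 + ‖D.K (D.sol p ζ) - ζ‖ ^ 2

theorem offset_nonneg (p : E) (ζ : W) : 0 ≤ D.offset p ζ := by unfold offset; positivity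

theorem env_eq (p : E) (ζ : W) : D.env p ζ = D.cost (D.sol p ζ) + D.ρ / 2 * D.offset p ζ := by
  rw [env, prox, offset]; ring

/-- The old solution is a competitor for the new centres, and convexity of the squared norm along
the relaxation gives the drop. The error term arises because the centres move towards `v'`, `a'`
rather than towards the exact solution. -/
theorem env_relaxed_le (p : E) (ζ : W) (v' : E) (a' : W) {β : ℝ} (h0 : 0 ≤ β) (h1 : β ≤ 1) :
    D.env (p + β • (v' - p)) (ζ + β • (a' - ζ)) ≤ D.env p ζ - D.ρ * β / 2 * D.offset p ζ
      + D.ρ * β / 2 * (‖v' - D.sol p ζ‖ ^ 2 + ‖a' - D.K (D.sol p ζ)‖ ^ 2) := by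
  refine (D.prox_sol_le _ _ (D.sol_mem p ζ)).trans ?_
  have t1 := norm_sub_relaxed_sq_le (D.sol p ζ) p v' h0 h1
  have t2 := norm_sub_relaxed_sq_le (D.K (D.sol p ζ)) ζ a' h0 h1
  have hρ := D.ρ_pos
  rw [env_eq, prox, offset]
  calc _ ≤ D.cost (D.sol p ζ)
      + D.ρ / 2 * ((1 - β) * ‖D.sol p ζ - p‖ ^ 2 + β * ‖v' - D.sol p ζ‖ ^ 2)
      + D.ρ / 2 * ((1 - β) * ‖D.K (D.sol p ζ) - ζ‖ ^ 2
        + β * ‖a' - D.K (D.sol p ζ)‖ ^ 2) := by gcongr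
    _ = _ := by ring

theorem exists_le_env : ∃ m : ℝ, ∀ p ζ, m ≤ D.env p ζ := by
  obtain ⟨v, hv, hmin⟩ := D.isCompact_X.exists_isMinOn D.exists_feasible
    D.continuous_cost.continuousOn
  refine ⟨D.cost v, fun p ζ => ?_⟩
  have h1 : D.cost v ≤ D.cost (D.sol p ζ) := hmin (D.sol_mem p ζ)
  have := D.offset_nonneg p ζ
  have := D.ρ_pos
  rw [env_eq]
  nlinarith

theorem norm_relax_sub_add_sq_le (p : E) (ζ a y : W) (v' : E) (a' y' : W) {β : ℝ} (h0 : 0 ≤ β) :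
    (‖(p + β • (v' - p)) - p‖ + ‖(ζ + β • (a' - ζ)) - ζ‖) ^ 2
      ≤ β ^ 2 * (4 * (D.offset p ζ + D.disp p ζ a y v' a' y' ^ 2)) := by
  rw [add_sub_cancel_left, add_sub_cancel_left, norm_smul, norm_smul, Real.norm_of_nonneg h0,
    ← mul_add, mul_pow, offset, disp]
  refine mul_le_mul_of_nonneg_left ?_ (by positivity)
  have t1 := norm_sub_le_norm_sub_add_norm_sub v' (D.sol p ζ) p
  have t2 := norm_sub_le_norm_sub_add_norm_sub a' (D.K (D.sol p ζ)) ζ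
  have t3 := norm_nonneg (a' - a)
  have t4 := norm_nonneg (y' - y)
  have g1 := norm_nonneg (v' - D.sol p ζ)
  have g2 := norm_nonneg (a' - D.K (D.sol p ζ))
  have g3 := norm_nonneg (v' - p)
  have g4 := norm_nonneg (a' - ζ)
  generalize ‖v' - p‖ = z₁ at *
  generalize ‖a' - ζ‖ = z₂ at *
  generalize ‖v' - D.sol p ζ‖ = x₁ at *
  generalize ‖a' - D.K (D.sol p ζ)‖ = x₂ at *
  generalize ‖D.sol p ζ - p‖ = x₃ at *
  generalize ‖D.K (D.sol p ζ) - ζ‖ = x₄ at *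
  generalize ‖a' - a‖ = x₅ at *
  generalize ‖y' - y‖ = x₆ at *
  have b1 : z₁ + z₂ ≤ x₁ + x₂ + x₃ + x₄ := by linarith
  have b2 := pow_le_pow_left₀ (by positivity) b1 2
  have b3 : (x₁ + x₂) ^ 2 ≤ (x₁ + x₂ + x₅ + x₆) ^ 2 :=
    pow_le_pow_left₀ (by positivity) (by linarith) 2
  nlinarith [sq_nonneg (x₁ + x₂ - x₃ - x₄), sq_nonneg (x₃ - x₄)]

variable [FiniteDimensional ℝ W]

/-- The potential function of the proximal ADMM. -/
noncomputable def potential (a y : W) (p : E) (ζ : W) : ℝ := D.env p ζ + D.gap a y p ζ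

/-- The error bound concerns the gap after a step; this carries it over to the gap before. -/
theorem gap_le_two_mul_gap_add (p : E) (ζ a y : W) (v' : E) (a' y' : W) :
    D.gap a y p ζ
      ≤ 2 * D.gap a' y' p ζ + (2 * D.μ⁻¹ + 4 * D.μ) * D.disp p ζ a y v' a' y' ^ 2 := by
  have hμ := D.μ_pos
  have n1 : Metric.infDist y (D.dualSet p ζ)
      ≤ Metric.infDist y' (D.dualSet p ζ) + D.disp p ζ a y v' a' y' := by
    refine (Metric.infDist_le_infDist_add_dist (y := y')).trans ?_
    rw [dist_comm, dist_eq_norm, disp]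
    gcongr
    exact le_add_of_nonneg_left (by positivity)
  have n2 : ‖a - D.K (D.sol p ζ)‖ ≤ D.disp p ζ a y v' a' y' := by
    have := norm_sub_le_norm_sub_add_norm_sub a a' (D.K (D.sol p ζ))
    rw [norm_sub_rev a a'] at this
    rw [disp]
    linarith [norm_nonneg (v' - D.sol p ζ), norm_nonneg (y' - y)]
  have m1 := pow_le_pow_left₀ Metric.infDist_nonneg n1 2
  have m2 := pow_le_pow_left₀ (norm_nonneg _) n2 2
  have m4 := add_sq_le (a := Metric.infDist y' (D.dualSet p ζ))
    (b := D.disp p ζ a y v' a' y')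
  have m5 := mul_le_mul_of_nonneg_left (m1.trans m4) (inv_pos.2 hμ).le
  have m6 := mul_le_mul_of_nonneg_left m2 hμ.le
  have m7 : 0 ≤ D.μ * D.disp p ζ a y v' a' y' ^ 2 := by positivity
  have m8 : 0 ≤ D.μ * ‖a' - D.K (D.sol p ζ)‖ ^ 2 := by positivity
  rw [gap, gap]
  linarith

variable [Fintype ι]

/-- Sufficient decrease of the potential function for small relaxation parameters `β`. -/
theorem exists_potential_decrease (G : ℝ) : ∃ β₀ κ : ℝ, 0 < β₀ ∧ 0 < κ ∧
    ∀ β : ℝ, 0 < β → β ≤ 1 → β < β₀ → ∀ (p : E) (ζ a y : W) (v' : E) (a' y' : W),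
      D.Step p ζ a y v' a' y' → D.gap a y p ζ ≤ G →
      D.potential a' y' (p + β • (v' - p)) (ζ + β • (a' - ζ)) + D.ρ * β / 4 * D.offset p ζ
          + κ⁻¹ * D.disp p ζ a y v' a' y' ^ 2 ≤ D.potential a y p ζ ∧
        D.gap a y p ζ ≤ κ * D.disp p ζ a y v' a' y' ^ 2 := by
  obtain ⟨κ₁, hκ₁, h1⟩ := D.exists_disp_sq_le
  obtain ⟨κ₂, hκ₂, h2⟩ := D.exists_gap_le_disp_sq G
  obtain ⟨κ₃, hκ₃, h3⟩ := D.exists_gap_drift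
  have hμ := D.μ_pos
  have hρ := D.ρ_pos
  -- The error bound gives `gap ≤ κ₁ κ₂ S` after the step, so this `τ` makes the relative drift cost
  -- at most `S / 4`.
  set τ := (4 * (κ₁ * κ₂))⁻¹ with hτ
  have hτ0 : 0 < τ := by positivity
  set κ₄ := (1 + τ⁻¹) * (κ₃ * 4) with hκ₄
  have hκ₄0 : 0 ≤ κ₄ := by positivity
  -- The three bounds keep the drift below `ρ β / 4 * U` and `S / 8`, and the error in `env` below
  -- `S / 8`. Of the gains `ρ β / 2 * U` and `S`, half of each survives.
  refine ⟨min (D.ρ / (4 * (κ₄ + 1))) (min (1 / (8 * (κ₄ * κ₁ + 1))) (1 / (4 * (D.ρ * κ₁ + 1)))),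
    2 * κ₁ + (2 * κ₂ + (2 * D.μ⁻¹ + 4 * D.μ)), by positivity, by positivity,
    fun β hβ hβ1 hβ0 p ζ a y v' a' y' h hG => ?_⟩
  have b1 := (hβ0.trans_le (min_le_left _ _)).le
  have b2 := (hβ0.trans_le ((min_le_right _ _).trans (min_le_left _ _))).le
  have b3 := (hβ0.trans_le ((min_le_right _ _).trans (min_le_right _ _))).le
  rw [le_div_iff₀ (by positivity)] at b1 b2 b3
  have hgap := h.gap_le
  have he := h1 _ _ _ _ _ _ _ h
  have hg := h2 _ _ _ _ _ _ _ h hG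
  have henv := D.env_relaxed_le p ζ v' a' hβ.le hβ1
  have hdrift := h3 a' y' p (p + β • (v' - p)) ζ (ζ + β • (a' - ζ)) τ hτ0
  have hmove := D.norm_relax_sub_add_sq_le p ζ a y v' a' y' hβ.le
  have hU := D.offset_nonneg p ζ
  have hpre : D.gap a y p ζ
      ≤ (2 * κ₂ + (2 * D.μ⁻¹ + 4 * D.μ)) * D.disp p ζ a y v' a' y' ^ 2 := by
    have := D.gap_le_two_mul_gap_add p ζ a y v' a' y'
    linarith
  have hΔ : ‖v' - D.sol p ζ‖ ^ 2 + ‖a' - D.K (D.sol p ζ)‖ ^ 2 ≤ D.disp p ζ a y v' a' y' ^ 2 := by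
    rw [disp]
    have t1 := norm_nonneg (v' - D.sol p ζ)
    have t2 := norm_nonneg (a' - D.K (D.sol p ζ))
    have t3 := norm_nonneg (a' - a)
    have t4 := norm_nonneg (y' - y)
    have t5 := pow_le_pow_left₀ (add_nonneg t1 t2)
      (show ‖v' - D.sol p ζ‖ + ‖a' - D.K (D.sol p ζ)‖
        ≤ ‖v' - D.sol p ζ‖ + ‖a' - D.K (D.sol p ζ)‖ + ‖a' - a‖ + ‖y' - y‖ by linarith) 2
    nlinarith [mul_nonneg t1 t2]
  have hg0 := D.gap_nonneg a' y' p ζ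
  set U := D.offset p ζ with hUdef
  set S := D.decrease p ζ a v' a' with hS
  set e2 := D.disp p ζ a y v' a' y' ^ 2 with he2
  have he0 : 0 ≤ e2 := sq_nonneg _
  have hS0 : 0 ≤ S := by
    exact nonneg_of_mul_nonneg_right (he0.trans he) hκ₁
  refine ⟨?_, hpre.trans (mul_le_mul_of_nonneg_right (by linarith) he0)⟩
  have hτg : τ * D.gap a' y' p ζ ≤ S / 4 := by
    calc τ * D.gap a' y' p ζ ≤ τ * (κ₂ * (κ₁ * S)) := by
          refine mul_le_mul_of_nonneg_left (hg.trans ?_) hτ0.le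
          gcongr
      _ = S / 4 := by rw [hτ]; field_simp
  have hd2 : D.gap a' y' (p + β • (v' - p)) (ζ + β • (a' - ζ))
      ≤ D.gap a' y' p ζ + S / 4 + κ₄ * β ^ 2 * (U + κ₁ * S) := by
    refine hdrift.trans ?_
    rw [add_mul, one_mul]
    refine add_le_add (by linarith) ?_
    calc _ ≤ (1 + τ⁻¹) * (κ₃ * (β ^ 2 * (4 * (U + κ₁ * S)))) := by
          gcongr
          exact hmove.trans (by gcongr)
      _ = _ := by rw [hκ₄]; ring
  have henv2 : D.env (p + β • (v' - p)) (ζ + β • (a' - ζ))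
      ≤ D.env p ζ - D.ρ * β / 2 * U + D.ρ * β / 2 * (κ₁ * S) := by
    refine henv.trans ?_
    gcongr
    exact hΔ.trans he
  have hβ2 : β ^ 2 ≤ β := pow_le_of_le_one hβ.le hβ1 two_ne_zero
  have c1 : κ₄ * β ^ 2 * U ≤ D.ρ * β / 4 * U := by
    refine mul_le_mul_of_nonneg_right ?_ hU
    have := mul_le_mul_of_nonneg_right b1 hβ.le
    linarith [sq_nonneg β]
  have c2 : κ₄ * β ^ 2 * (κ₁ * S) ≤ S / 8 := by
    have t1 : κ₄ * κ₁ * β ^ 2 ≤ κ₄ * κ₁ * β := mul_le_mul_of_nonneg_left hβ2 (by positivity)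
    have t2 : κ₄ * κ₁ * β ^ 2 ≤ 1 / 8 := by linarith
    linarith [mul_le_mul_of_nonneg_right t2 hS0]
  have c3 : D.ρ * β / 2 * (κ₁ * S) ≤ S / 8 := by
    have t1 : D.ρ * β / 2 * κ₁ ≤ 1 / 8 := by linarith
    linarith [mul_le_mul_of_nonneg_right t1 hS0]
  have c4 : (2 * κ₁ + (2 * κ₂ + (2 * D.μ⁻¹ + 4 * D.μ)))⁻¹ * e2 ≤ S / 2 := by
    calc _ ≤ (2 * κ₁)⁻¹ * e2 := by
          gcongr
          exact le_add_of_nonneg_right (by positivity)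
      _ ≤ (2 * κ₁)⁻¹ * (κ₁ * S) := by gcongr
      _ = S / 2 := by field_simp
  rw [potential, potential]
  linarith

end Program
end PolyhedralADMM

/-! ### Stationary values on the faces of the feasible polyhedron. -/

namespace PolyhedralADMM
namespace Program

variable {E W ι : Type*} [NormedAddCommGroup E] [InnerProductSpace ℝ E]
  [NormedAddCommGroup W] [InnerProductSpace ℝ W] (D : Program E W ι)

/-- The trapezoidal rule is exact for quadratics. -/
theorem cost_sub_cost (v v' : E) :
    D.cost v - D.cost v' = 1 / 2 * inner ℝ (D.grad v + D.grad v') (v - v') := by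
  simp only [cost, grad, inner_add_left, inner_sub_left, inner_sub_right, real_inner_smul_left,
    real_inner_self_eq_norm_sq, real_inner_comm v v']
  ring

variable [Fintype ι]

/-- Two points on the face with active set `I` that satisfy the stationarity condition up to `r`
and `r'`, with multipliers supported on `I`. -/
theorem cost_sub_cost_of_stationary {N : ι → E} {c : ι → ℝ} {I : Finset ι} {v v' r r' : E}
    {θ θ' : ι → ℝ} (hv : ∀ i ∈ I, inner ℝ (N i) v = c i) (hv' : ∀ i ∈ I, inner ℝ (N i) v' = c i)
    (hθ : ∀ i ∉ I, θ i = 0) (hθ' : ∀ i ∉ I, θ' i = 0)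
    (hr : D.grad v + ∑ i, θ i • N i = r) (hr' : D.grad v' + ∑ i, θ' i • N i = r') :
    D.cost v - D.cost v' = 1 / 2 * inner ℝ (r + r') (v - v') := by
  -- Combinations of the active normals are orthogonal to differences of points on the face.
  have key : ∀ t : ι → ℝ, (∀ i ∉ I, t i = 0) → inner ℝ (∑ i, t i • N i) (v - v') = 0 := by
    intro t ht
    rw [sum_inner]
    refine Finset.sum_eq_zero fun i _ => ?_
    by_cases hi : i ∈ I
    · rw [real_inner_smul_left, inner_sub_right, hv i hi, hv' i hi, sub_self, mul_zero]
    · rw [ht i hi, zero_smul, inner_zero_left]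
  rw [cost_sub_cost, ← hr, ← hr']
  have h1 := key θ hθ
  have h2 := key θ' hθ'
  simp only [inner_add_left] at h1 h2 ⊢
  rw [h1, h2]
  ring

variable [FiniteDimensional ℝ E]

/-- On a face of a polyhedron, the cost of an approximate stationary point is quadratically close
to the unique stationary value belonging to this face. -/
theorem exists_stationary_value (N : ι → E) (c : ι → ℝ) (I : Finset ι) :
    ∃ s κ δ : ℝ, 0 < κ ∧ 0 < δ ∧ ∀ (v : E) (θ : EuclideanSpace ℝ ι), v ∈ poly N c →
      (∀ i, 0 ≤ θ i) → (∀ i ∈ I, inner ℝ (N i) v = c i) → (∀ i ∉ I, θ i = 0) →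
      ‖D.grad v + ∑ i, θ i • N i‖ < δ →
      |D.cost v - s| ≤ κ * ‖D.grad v + ∑ i, θ i • N i‖ ^ 2 := by
  classical
  set π₁ := WithLp.fstL 2 ℝ E (EuclideanSpace ℝ ι) with hπ₁
  set π₂ := WithLp.sndL 2 ℝ E (EuclideanSpace ℝ ι) with hπ₂
  set f : ι ⊕ ι → WithLp 2 (E × EuclideanSpace ℝ ι) →L[ℝ] ℝ :=
    Sum.elim (fun i => (innerSL ℝ (N i)).comp π₁)
      (fun i => -(EuclideanSpace.proj i : EuclideanSpace ℝ ι →L[ℝ] ℝ).comp π₂) with hf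
  set d : ι ⊕ ι → ℝ := Sum.elim c fun _ => 0 with hd
  -- `L x = t` is the linear system of exact stationarity on the face `I` for a point and its
  -- multipliers; `L x - t` is the residual.
  set L : WithLp 2 (E × EuclideanSpace ℝ ι) →L[ℝ] E × (ι → ℝ) :=
    (-(D.α • π₁) + ((ContinuousLinearMap.fst ℝ E ℝ).comp (combine N c)).comp π₂).prod
      (ContinuousLinearMap.pi fun i => if i ∈ I then (innerSL ℝ (N i)).comp π₁
        else (EuclideanSpace.proj i : EuclideanSpace ℝ ι →L[ℝ] ℝ).comp π₂) with hL
  set t : E × (ι → ℝ) := (-D.l, fun i => if i ∈ I then c i else 0) with ht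
  have hfx : ∀ x, (∀ i, f i x ≤ d i) ↔ x.fst ∈ poly N c ∧ ∀ i, 0 ≤ x.snd i := by
    intro x
    simp [hf, hd, hπ₁, hπ₂, Sum.forall, poly]
  have hLt : ∀ x, (L x - t).1 = D.grad x.fst + ∑ i, x.snd i • N i := by
    intro x
    simp [hL, ht, hπ₁, hπ₂, combine_fst, grad]
    abel
  have hL2 : ∀ x i, (L x).2 i = if i ∈ I then inner ℝ (N i) x.fst else x.snd i := by
    intro x i
    by_cases hi : i ∈ I <;> simp [hL, hπ₁, hπ₂, hi]
  have hnorm : ∀ x, (∀ i ∈ I, inner ℝ (N i) x.fst = c i) → (∀ i ∉ I, x.snd i = 0) →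
      ‖L x - t‖ = ‖D.grad x.fst + ∑ i, x.snd i • N i‖ := by
    intro x h1 h2
    have : (L x - t).2 = 0 := by
      ext i
      rw [Prod.snd_sub, Pi.sub_apply, hL2]
      by_cases hi : i ∈ I
      · simp [ht, hi, h1 i hi]
      · simp [ht, hi, h2 i hi]
    rw [Prod.norm_def, this, hLt]
    simp
  have hexact : ∀ x, L x = t → (∀ i ∈ I, inner ℝ (N i) x.fst = c i) ∧ (∀ i ∉ I, x.snd i = 0) ∧
      D.grad x.fst + ∑ i, x.snd i • N i = 0 := by
    intro x hx
    refine ⟨fun i hi => ?_, fun i hi => ?_, ?_⟩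
    · have := hL2 x i
      rw [hx] at this
      simpa [ht, hi] using this.symm
    · have := hL2 x i
      rw [hx] at this
      simpa [ht, hi] using this.symm
    · rw [← hLt, hx, sub_self, Prod.fst_zero]
  by_cases hmem : t ∈ L '' {x | ∀ i, f i x ≤ d i}
  · obtain ⟨x₀, hx₀, hx₀t⟩ := hmem
    obtain ⟨κ, hκ, hoff⟩ := exists_hoffman f L
    refine ⟨D.cost x₀.fst, κ + 1, 1, by positivity, one_pos, fun v θ hv hθ h1 h2 _ => ?_⟩
    obtain ⟨x', hx', heq, hle⟩ := hoff d (WithLp.toLp 2 (v, θ)) x₀ ((hfx _).2 ⟨hv, hθ⟩) hx₀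
    rw [hx₀t, hnorm (WithLp.toLp 2 (v, θ)) h1 h2] at hle
    rw [hx₀t] at heq
    obtain ⟨a1, a2, a3⟩ := hexact _ heq
    obtain ⟨b1, b2, b3⟩ := hexact _ hx₀t
    -- Two exact stationary points have zero residual, hence equal cost; so it does not matter which
    -- one Hoffman's bound returns. The approximate point differs from it in cost by half the
    -- pairing of a residual `r` with a displacement `O(‖r‖)`.
    have e1 := D.cost_sub_cost_of_stationary a1 b1 a2 b2 a3 b3
    have e2 := D.cost_sub_cost_of_stationary h1 a1 h2 a2 rfl a3
    rw [add_zero, inner_zero_left, mul_zero] at e1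
    rw [add_zero] at e2
    have hfst : ‖v - x'.fst‖ ≤ ‖(WithLp.toLp 2 (v, θ) : WithLp 2 (E × EuclideanSpace ℝ ι)) - x'‖ := by
      refine le_of_sq_le_sq ?_ (norm_nonneg _)
      rw [WithLp.prod_norm_sq_eq_of_L2]
      exact le_add_of_nonneg_right (sq_nonneg _)
    set r := D.grad v + ∑ i, θ i • N i with hr
    have hle' : ‖v - x'.fst‖ ≤ κ * ‖r‖ := hfst.trans hle
    rw [← sub_add_sub_cancel _ (D.cost x'.fst), e1, e2, add_zero, abs_mul,
      abs_of_nonneg (by norm_num : (0 : ℝ) ≤ 1 / 2)]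
    have := (abs_real_inner_le_norm r (v - x'.fst)).trans
      (mul_le_mul_of_nonneg_left hle' (norm_nonneg r))
    nlinarith [sq_nonneg ‖r‖, mul_nonneg hκ (sq_nonneg ‖r‖)]
  -- No exact stationary point belongs to this face. The image is closed, so residuals stay at least
  -- `δ` and the claim is vacuous.
  · obtain ⟨δ, hδ, hball⟩ := Metric.isOpen_iff.1
      (isClosed_image_polyhedron f L d).isOpen_compl t hmem
    refine ⟨0, 1, δ, one_pos, hδ, fun v θ hv hθ h1 h2 hr => ?_⟩
    exfalso
    have hin : L (WithLp.toLp 2 (v, θ)) ∈ Metric.ball t δ := by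
      rw [mem_ball_iff_norm, hnorm (WithLp.toLp 2 (v, θ)) h1 h2]
      exact hr
    exact hball hin ⟨_, (hfx (WithLp.toLp 2 (v, θ))).2 ⟨hv, hθ⟩, rfl⟩

variable [FiniteDimensional ℝ W]

/-- By complementary slackness the regularized solution lies on the face of its active constraints
with a multiplier supported there. It is stationary for the original cost up to the two proximal
terms, whose squared size is bounded by a multiple of `offset`. -/
theorem exists_stationary_values : ∃ (s : Finset ι → ℝ) (κ δ : ℝ), 0 < κ ∧ 0 < δ ∧
    ∀ (p : E) (ζ : W), D.offset p ζ < δ →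
      ∃ I, |D.cost (D.sol p ζ) - s I| ≤ κ * D.offset p ζ := by
  classical
  choose s κ δ hκ hδ h using
    D.exists_stationary_value (fun i => D.K.adjoint (D.n i)) D.c
  have hρ := D.ρ_pos
  obtain ⟨κ', hκ'⟩ : ∃ κ', ∀ I, κ I ≤ κ' :=
    ⟨∑ I, κ I, fun I => Finset.single_le_sum (fun J _ => (hκ J).le) (Finset.mem_univ I)⟩
  have hκ'0 : 0 < κ' := (hκ ∅).trans_le (hκ' ∅)
  obtain ⟨ε, hε, hεδ⟩ : ∃ ε : ℝ, 0 < ε ∧ ∀ I, ε ≤ δ I := by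
    obtain ⟨I, -, hI⟩ := Finset.exists_min_image Finset.univ δ ⟨∅, by simp⟩
    exact ⟨δ I, hδ I, fun J => hI J (by simp)⟩
  set B := 2 * (D.ρ * (1 + ‖D.K‖)) ^ 2 with hB
  have hB0 : 0 < B := by positivity
  refine ⟨s, κ' * B, ε ^ 2 / B, by positivity, by positivity, fun p ζ hoff => ?_⟩
  have hX : D.K ⁻¹' poly D.n D.c = poly (fun i => D.K.adjoint (D.n i)) D.c := by
    ext v; simp [poly, ContinuousLinearMap.adjoint_inner_left]
  have hsol : D.sol p ζ ∈ poly (fun i => D.K.adjoint (D.n i)) D.c := by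
    rw [← hX]; exact D.sol_mem p ζ
  obtain ⟨θ, hθ, hθw⟩ := exists_multiplier (fun i => D.K.adjoint (D.n i)) D.c hsol
    (by rw [← hX]; exact D.normalAt_force p ζ)
  have h1 : ∑ i, θ i • D.K.adjoint (D.n i) = D.force p ζ := by
    rw [← combine_fst, hθw]
  have h2 : ∑ i, θ i * D.c i = inner ℝ (D.force p ζ) (D.sol p ζ) := by
    rw [← combine_snd (fun i => D.K.adjoint (D.n i)), hθw]
  have hcompl : ∀ i, θ i * (D.c i - inner ℝ (D.K.adjoint (D.n i)) (D.sol p ζ)) = 0 := by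
    have hsum : ∑ i, θ i * (D.c i - inner ℝ (D.K.adjoint (D.n i)) (D.sol p ζ)) = 0 := by
      simp only [mul_sub, Finset.sum_sub_distrib, h2, ← h1, sum_inner, real_inner_smul_left,
        sub_self]
    intro i
    exact (Finset.sum_eq_zero_iff_of_nonneg fun j _ =>
      mul_nonneg (hθ j) (sub_nonneg.2 (hsol j))).1 hsum i (Finset.mem_univ i)
  set I : Finset ι :=
    Finset.univ.filter fun i => inner ℝ (D.K.adjoint (D.n i)) (D.sol p ζ) = D.c i with hI
  have hr : D.grad (D.sol p ζ) + ∑ i, θ i • D.K.adjoint (D.n i)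
      = -(D.ρ • (D.sol p ζ - p)) - D.ρ • D.K.adjoint (D.K (D.sol p ζ) - ζ) := by
    rw [h1, force]; abel
  have hrn : ‖D.grad (D.sol p ζ) + ∑ i, θ i • D.K.adjoint (D.n i)‖ ^ 2 ≤ B * D.offset p ζ := by
    have hn : ‖D.grad (D.sol p ζ) + ∑ i, θ i • D.K.adjoint (D.n i)‖
        ≤ D.ρ * (1 + ‖D.K‖) * (‖D.sol p ζ - p‖ + ‖D.K (D.sol p ζ) - ζ‖) := by
      rw [hr]
      refine (norm_sub_le _ _).trans ?_
      rw [norm_neg, norm_smul, norm_smul, Real.norm_of_nonneg hρ.le, ← mul_add, mul_assoc]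
      refine mul_le_mul_of_nonneg_left ?_ hρ.le
      have := D.norm_adjoint_apply_le (D.K (D.sol p ζ) - ζ)
      have := mul_nonneg (norm_nonneg D.K) (norm_nonneg (D.sol p ζ - p))
      have := norm_nonneg (D.K (D.sol p ζ) - ζ)
      linarith
    calc _ ≤ (D.ρ * (1 + ‖D.K‖) * (‖D.sol p ζ - p‖ + ‖D.K (D.sol p ζ) - ζ‖)) ^ 2 :=
          pow_le_pow_left₀ (norm_nonneg _) hn 2
      _ = (D.ρ * (1 + ‖D.K‖)) ^ 2 * (‖D.sol p ζ - p‖ + ‖D.K (D.sol p ζ) - ζ‖) ^ 2 := by ring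
      _ ≤ (D.ρ * (1 + ‖D.K‖)) ^ 2 * (2 * (‖D.sol p ζ - p‖ ^ 2 + ‖D.K (D.sol p ζ) - ζ‖ ^ 2)) := by
          gcongr; exact add_sq_le
      _ = _ := by rw [hB, offset]; ring
  refine ⟨I, (h I _ θ hsol hθ (fun i hi => by simpa [hI] using hi) (fun i hi => ?_) ?_).trans ?_⟩
  · have hne : inner ℝ (D.K.adjoint (D.n i)) (D.sol p ζ) ≠ D.c i := by simpa [hI] using hi
    exact (mul_eq_zero.1 (hcompl i)).resolve_right (sub_ne_zero.2 hne.symm)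
  · refine lt_of_pow_lt_pow_left₀ 2 (hδ I).le (hrn.trans_lt ?_)
    rw [lt_div_iff₀ hB0, mul_comm] at hoff
    exact hoff.trans_le (pow_le_pow_left₀ hε.le (hεδ I) 2)
  · rw [mul_assoc]
    exact mul_le_mul (hκ' I) hrn (sq_nonneg _) hκ'0.le

/-! ### Convergence of the iteration. -/

/-- A sequence generated by the proximal alternating direction method of multipliers. -/
structure IsRun (β : ℝ) (v p : ℕ → E) (a y ζ : ℕ → W) : Prop where
  step : ∀ k, D.Step (p k) (ζ k) (a k) (y k) (v (k + 1)) (a (k + 1)) (y (k + 1))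
  p_eq : ∀ k, p (k + 1) = p k + β • (v (k + 1) - p k)
  ζ_eq : ∀ k, ζ (k + 1) = ζ k + β • (a (k + 1) - ζ k)

theorem cauchySeq_of_norm_sub_le {V : Type*} [NormedAddCommGroup V] {x : ℕ → V} {d : ℕ → ℝ}
    (hd : Summable d) (h : ∀ k, ‖x (k + 1) - x k‖ ≤ d k) : CauchySeq x :=
  cauchySeq_of_dist_le_of_summable d (fun k => by rw [dist_comm, dist_eq_norm]; exact h k) hd

/-- The initial tuple is fixed before `β₀`, since the error bound is uniform only below a gap level,
which the initial potential determines. -/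
theorem exists_tendsto_of_isRun (a₀ y₀ ζ₀ : W) (p₀ : E) : ∃ β₀ : ℝ, 0 < β₀ ∧
    ∀ β : ℝ, 0 < β → β ≤ 1 → β < β₀ → ∀ (v p : ℕ → E) (a y ζ : ℕ → W), D.IsRun β v p a y ζ →
      a 0 = a₀ → y 0 = y₀ → ζ 0 = ζ₀ → p 0 = p₀ →
      ∃ (v' : E) (y' : W), Tendsto v atTop (𝓝 v') ∧ Tendsto p atTop (𝓝 v') ∧
        Tendsto a atTop (𝓝 (D.K v')) ∧ Tendsto y atTop (𝓝 y') ∧ Tendsto ζ atTop (𝓝 (D.K v')) ∧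
        D.K v' ∈ D.C ∧ ∀ x, D.K x ∈ D.C → 0 ≤ inner ℝ (D.grad v') (x - v') := by
  obtain ⟨m, hm⟩ := D.exists_le_env
  obtain ⟨β₀, κ, hβ₀, hκ, hdec⟩ :=
    D.exists_potential_decrease (D.potential a₀ y₀ p₀ ζ₀ - m)
  refine ⟨β₀, hβ₀, fun β hβ hβ1 hββ₀ v p a y ζ hrun ha hy hζ hp => ?_⟩
  have hρ := D.ρ_pos
  have hμ := D.μ_pos
  set φ : ℕ → ℝ := fun k => D.potential (a k) (y k) (p k) (ζ k) with hφ
  set e : ℕ → ℝ :=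
    fun k => D.disp (p k) (ζ k) (a k) (y k) (v (k + 1)) (a (k + 1)) (y (k + 1)) with he
  set U : ℕ → ℝ := fun k => D.offset (p k) (ζ k) with hU
  set s : ℕ → ℝ := fun k => U k + e k ^ 2 with hs
  have hU0 : ∀ k, 0 ≤ U k := fun k => D.offset_nonneg _ _
  have hs0 : ∀ k, 0 ≤ s k := fun k => add_nonneg (hU0 k) (sq_nonneg _)
  have hgap : ∀ k, D.gap (a k) (y k) (p k) (ζ k) ≤ φ k - m := fun k => by
    simp only [hφ, potential]; linarith [hm (p k) (ζ k)]
  have hstep : ∀ k, φ k ≤ φ 0 → φ (k + 1) + D.ρ * β / 4 * U k + κ⁻¹ * e k ^ 2 ≤ φ k ∧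
      D.gap (a k) (y k) (p k) (ζ k) ≤ κ * e k ^ 2 := by
    intro k hk
    have h0 : D.potential a₀ y₀ p₀ ζ₀ = φ 0 := by simp only [hφ, ha, hy, hp, hζ]
    have := hdec β hβ hβ1 hββ₀ _ _ _ _ _ _ _ (hrun.step k)
      ((hgap k).trans (by rw [h0]; linarith))
    rwa [← hrun.p_eq, ← hrun.ζ_eq] at this
  -- The decrease at step `k` needs the gap bound, which follows from `φ k ≤ φ 0`; hence the
  -- induction.
  have hφ0 : ∀ k, φ k ≤ φ 0 := by
    intro k
    induction k with
    | zero => exact le_rfl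
    | succ k ih =>
      have := (hstep k ih).1
      have : 0 ≤ D.ρ * β / 4 * U k := mul_nonneg (by positivity) (hU0 k)
      have : 0 ≤ κ⁻¹ * e k ^ 2 := by positivity
      linarith
  set c := min (D.ρ * β / 4) κ⁻¹ with hc
  have hc0 : 0 < c := by positivity
  have hφdec : ∀ k, φ (k + 1) + c * s k ≤ φ k := by
    intro k
    have h1 := (hstep k (hφ0 k)).1
    have h2 : c * U k ≤ D.ρ * β / 4 * U k := mul_le_mul_of_nonneg_right (min_le_left _ _) (hU0 k)
    have h3 : c * e k ^ 2 ≤ κ⁻¹ * e k ^ 2 :=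
      mul_le_mul_of_nonneg_right (min_le_right _ _) (sq_nonneg _)
    simp only [hs, mul_add]
    linarith
  have hanti : Antitone φ := antitone_nat_of_succ_le fun k => by
    have := hφdec k
    have := mul_nonneg hc0.le (hs0 k)
    linarith
  have hbdd : BddBelow (Set.range φ) := ⟨m, by
    rintro _ ⟨k, rfl⟩
    have := (D.gap_nonneg (a k) (y k) (p k) (ζ k)).trans (hgap k)
    linarith⟩
  set φ₀ := ⨅ k, φ k with hφ₀
  have hlim : Tendsto φ atTop (𝓝 φ₀) := tendsto_atTop_ciInf hanti hbdd
  have hge : ∀ k, φ₀ ≤ φ k := fun k => ciInf_le hbdd k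
  have hslim : Tendsto s atTop (𝓝 0) := by
    have h1 : Tendsto (fun k => c⁻¹ * (φ k - φ (k + 1))) atTop (𝓝 0) := by
      have := (hlim.sub ((tendsto_add_atTop_iff_nat 1).2 hlim)).const_mul c⁻¹
      rwa [sub_self, mul_zero] at this
    refine squeeze_zero hs0 (fun k => ?_) h1
    rw [← div_eq_inv_mul, le_div_iff₀ hc0]
    linarith [hφdec k]
  have hUs : ∀ k, U k ≤ s k := fun k => le_add_of_nonneg_right (sq_nonneg _)
  have hes : ∀ k, e k ^ 2 ≤ s k := fun k => le_add_of_nonneg_left (hU0 k)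
  have hφcost : ∀ k, φ k = D.cost (D.sol (p k) (ζ k)) + D.ρ / 2 * U k
      + D.gap (a k) (y k) (p k) (ζ k) := fun k => by
    simp only [hφ, potential, env_eq, hU]
  have hcost : Tendsto (fun k => D.cost (D.sol (p k) (ζ k))) atTop (𝓝 φ₀) := by
    have h1 : Tendsto (fun k => φ k - (D.ρ / 2 + κ) * s k) atTop (𝓝 φ₀) := by
      have := hlim.sub (hslim.const_mul (D.ρ / 2 + κ))
      rwa [mul_zero, sub_zero] at this
    refine tendsto_of_tendsto_of_tendsto_of_le_of_le h1 hlim (fun k => ?_) (fun k => ?_)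
    · have t1 := (hstep k (hφ0 k)).2
      have t2 := mul_le_mul_of_nonneg_left (hUs k) (half_pos hρ).le
      have t3 := mul_le_mul_of_nonneg_left (hes k) hκ.le
      simp only
      linarith [hφcost k]
    · have t1 := D.gap_nonneg (a k) (y k) (p k) (ζ k)
      have t2 := mul_nonneg (half_pos hρ).le (hU0 k)
      simp only
      linarith [hφcost k]
  obtain ⟨val, κ', δ, hκ', hδ, hval⟩ := D.exists_stationary_values
  -- The costs of the regularized solutions converge to `φ₀` and approach the finitely many values
  -- `val I`. Eventually only those equal to `φ₀` can occur, and the quadratic error bound then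
  -- compares the excess with `s k`.
  have hev : ∀ᶠ k in atTop, φ k - φ₀ ≤ (κ' + D.ρ / 2 + κ) * s k := by
    have h1 : ∀ᶠ k in atTop, U k < δ := by
      filter_upwards [hslim.eventually_lt_const hδ] with k hk using (hUs k).trans_lt hk
    have h2 : ∀ᶠ k in atTop, ∀ I, |D.cost (D.sol (p k) (ζ k)) - val I| ≤ κ' * s k →
        val I = φ₀ := by
      refine eventually_all.2 fun I => ?_
      by_cases hI : val I = φ₀
      · exact Eventually.of_forall fun _ _ => hI
      · have t1 : Tendsto (fun k => |D.cost (D.sol (p k) (ζ k)) - val I| - κ' * s k) atTop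
            (𝓝 |φ₀ - val I|) := by
          have := ((hcost.sub_const (val I)).abs).sub (hslim.const_mul κ')
          rwa [mul_zero, sub_zero] at this
        have t2 : 0 < |φ₀ - val I| := abs_pos.2 (sub_ne_zero.2 (Ne.symm hI))
        filter_upwards [t1.eventually_const_lt t2] with k hk hk'
        linarith
    filter_upwards [h1, h2] with k hk1 hk2
    obtain ⟨I, hI⟩ := hval _ _ hk1
    have t0 : κ' * U k ≤ κ' * s k := mul_le_mul_of_nonneg_left (hUs k) hκ'.le
    have t1 := hk2 I (hI.trans t0)
    rw [t1] at hI
    have t2 := (le_abs_self _).trans (hI.trans t0)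
    have t3 := (hstep k (hφ0 k)).2
    have t4 := mul_le_mul_of_nonneg_left (hUs k) (half_pos hρ).le
    have t5 := mul_le_mul_of_nonneg_left (hes k) hκ.le
    linarith [hφcost k]
  have hsum : Summable fun k => √(s k) :=
    summable_sqrt_of_decrease hc0 (by positivity) hs0 hge hφdec hev
  have hsqrt : Tendsto (fun k => 2 * √(s k)) atTop (𝓝 0) := by
    have := hsum.tendsto_atTop_zero.const_mul 2
    rwa [mul_zero] at this
  have he0 : ∀ k, 0 ≤ e k := fun k => by simp only [he, disp]; positivity
  have hesq : ∀ k, e k ≤ √(s k) := fun k => Real.le_sqrt_of_sq_le (hes k)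
  have hp1 : ∀ k, ‖D.sol (p k) (ζ k) - p k‖ ≤ √(s k) := fun k =>
    Real.le_sqrt_of_sq_le (le_trans (le_add_of_nonneg_right (sq_nonneg _)) (hUs k))
  have hζ1 : ∀ k, ‖D.K (D.sol (p k) (ζ k)) - ζ k‖ ≤ √(s k) := fun k =>
    Real.le_sqrt_of_sq_le (le_trans (le_add_of_nonneg_left (sq_nonneg _)) (hUs k))
  have hparts : ∀ k, ‖v (k + 1) - D.sol (p k) (ζ k)‖ ≤ e k ∧
      ‖a (k + 1) - D.K (D.sol (p k) (ζ k))‖ ≤ e k ∧ ‖a (k + 1) - a k‖ ≤ e k ∧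
      ‖y (k + 1) - y k‖ ≤ e k := by
    intro k
    simp only [he, disp]
    have t1 := norm_nonneg (v (k + 1) - D.sol (p k) (ζ k))
    have t2 := norm_nonneg (a (k + 1) - D.K (D.sol (p k) (ζ k)))
    have t3 := norm_nonneg (a (k + 1) - a k)
    have t4 := norm_nonneg (y (k + 1) - y k)
    refine ⟨?_, ?_, ?_, ?_⟩ <;> linarith
  have hvp : ∀ k, ‖v (k + 1) - p k‖ ≤ 2 * √(s k) := fun k => by
    have := norm_sub_le_norm_sub_add_norm_sub (v (k + 1)) (D.sol (p k) (ζ k)) (p k)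
    linarith [(hparts k).1, hesq k, hp1 k]
  have haζ : ∀ k, ‖a (k + 1) - ζ k‖ ≤ 2 * √(s k) := fun k => by
    have := norm_sub_le_norm_sub_add_norm_sub (a (k + 1)) (D.K (D.sol (p k) (ζ k))) (ζ k)
    linarith [(hparts k).2.1, hesq k, hζ1 k]
  have hsum2 : Summable fun k => 2 * √(s k) := hsum.mul_left 2
  obtain ⟨p', hp'⟩ := cauchySeq_tendsto_of_complete (cauchySeq_of_norm_sub_le (x := p) hsum2
    fun k => by
      rw [hrun.p_eq, add_sub_cancel_left, norm_smul, Real.norm_of_nonneg hβ.le]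
      nlinarith [hvp k, norm_nonneg (v (k + 1) - p k)])
  obtain ⟨a', ha'⟩ := cauchySeq_tendsto_of_complete (cauchySeq_of_norm_sub_le (x := a) hsum
    fun k => (hparts k).2.2.1.trans (hesq k))
  obtain ⟨y', hy'⟩ := cauchySeq_tendsto_of_complete (cauchySeq_of_norm_sub_le (x := y) hsum
    fun k => (hparts k).2.2.2.trans (hesq k))
  have ha1 := (tendsto_add_atTop_iff_nat 1).2 ha'
  have hy1 := (tendsto_add_atTop_iff_nat 1).2 hy'
  have hvp0 : Tendsto (fun k => v (k + 1) - p k) atTop (𝓝 0) :=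
    squeeze_zero_norm hvp hsqrt
  have hv1 : Tendsto (fun k => v (k + 1)) atTop (𝓝 p') := by
    have := hvp0.add hp'
    simpa using this
  have hζ' : Tendsto ζ atTop (𝓝 a') := by
    have h1 : Tendsto (fun k => a (k + 1) - ζ k) atTop (𝓝 0) := squeeze_zero_norm haζ hsqrt
    have := ha1.sub h1
    simpa using this
  have hKa : D.K p' = a' := by
    have h1 : Tendsto (fun k => D.K (v (k + 1)) - a (k + 1)) atTop (𝓝 (D.K p' - a')) :=
      ((D.K.continuous.tendsto _).comp hv1).sub ha1
    have h2 : Tendsto (fun k => D.μ⁻¹ • (y (k + 1) - y k)) atTop (𝓝 0) := by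
      have := (hy1.sub hy').const_smul D.μ⁻¹
      rwa [sub_self, smul_zero] at this
    have h3 : (fun k => D.μ⁻¹ • (y (k + 1) - y k)) = fun k => D.K (v (k + 1)) - a (k + 1) := by
      ext k
      rw [(hrun.step k).dual_eq, add_sub_cancel_left, inv_smul_smul₀ hμ.ne']
    rw [h3] at h2
    exact sub_eq_zero.1 (tendsto_nhds_unique h1 h2)
  subst hKa
  have hmem : D.K p' ∈ D.C :=
    D.isClosed_C.mem_of_tendsto ha1 (Eventually.of_forall fun k => (hrun.step k).mem)
  have hgrad : D.grad p' + D.K.adjoint y' = 0 := by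
    have h1 : Tendsto (fun k => D.grad (v (k + 1)) + D.ρ • (v (k + 1) - p k)
        + D.K.adjoint (y (k + 1) + D.μ • (a (k + 1) - a k))) atTop
        (𝓝 (D.grad p' + D.ρ • (0 : E) + D.K.adjoint (y' + D.μ • (D.K p' - D.K p')))) := by
      refine Tendsto.add (Tendsto.add ?_ (hvp0.const_smul _))
        ((D.K.adjoint.continuous.tendsto _).comp (hy1.add ((ha1.sub ha').const_smul _)))
      exact tendsto_const_nhds.sub (hv1.const_smul _)
    simp only [(hrun.step _).grad_eq, sub_self, smul_zero, add_zero] at h1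
    exact tendsto_nhds_unique h1 tendsto_const_nhds
  have hnormal : NormalAt D.C (D.K p') y' := by
    intro x hx
    have h1 : Tendsto (fun k => y (k + 1) - D.ρ • (a (k + 1) - ζ k)) atTop (𝓝 y') := by
      have := hy1.sub ((ha1.sub hζ').const_smul D.ρ)
      rwa [sub_self, smul_zero, sub_zero] at this
    exact le_of_tendsto_of_tendsto' (h1.inner tendsto_const_nhds) (h1.inner ha1)
      fun k => (hrun.step k).normal x hx
  refine ⟨p', y', (tendsto_add_atTop_iff_nat 1).1 hv1, hp', ha', hy', hζ', hmem, fun x hx => ?_⟩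
  rw [eq_neg_of_add_eq_zero_left hgrad, inner_neg_left, ContinuousLinearMap.adjoint_inner_left,
    map_sub, inner_sub_right]
  linarith [hnormal _ hx]

end Program
end PolyhedralADMM

/-! ### Translation of the decoder into the abstract iteration. -/

namespace NonbinaryDecoder

open PolyhedralADMM

section Transfer

variable {R N : Type*} [Fintype R] [Fintype N] [DecidableEq N] {A : Matrix R N ℝ}
  {b : EuclideanSpace ℝ R} {lam : EuclideanSpace ℝ N} {α μ ρ β : ℝ}

/-- The center `(1/2, …, 1/2)` of the unit box. -/
noncomputable def boxCenter (N : Type*) : EuclideanSpace ℝ N := WithLp.toLp 2 fun _ => 1 / 2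

omit [DecidableEq N] in
theorem gradient_objective (lam : EuclideanSpace ℝ N) (α : ℝ) (v : EuclideanSpace ℝ N) :
    gradient (objective lam α) v = lam - α • (v - boxCenter N) := by
  refine HasGradientAt.gradient ?_
  rw [hasGradientAt_iff_hasFDerivAt]
  have h1 : HasFDerivAt (fun v : EuclideanSpace ℝ N => inner ℝ lam v) (innerSL ℝ lam) v :=
    (innerSL ℝ lam).hasFDerivAt
  have h2 := (((hasFDerivAt_id v).sub_const (boxCenter N)).norm_sq).const_mul (α / 2)
  refine (h1.sub h2).congr_fderiv ?_
  ext d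
  simp
  ring

omit [DecidableEq N] in
theorem objective_add_smul (v d : EuclideanSpace ℝ N) (t : ℝ) :
    objective lam α (v + t • d) = objective lam α v
      + t * inner ℝ (lam - α • (v - boxCenter N)) d + t ^ 2 * (-α / 2 * ‖d‖ ^ 2) := by
  have h1 : v + t • d - boxCenter N = (v - boxCenter N) + t • d := by abel
  change inner ℝ lam (v + t • d) - α / 2 * ‖v + t • d - boxCenter N‖ ^ 2
    = inner ℝ lam v - α / 2 * ‖v - boxCenter N‖ ^ 2 + _ + _
  rw [h1, norm_add_smul_sq]
  simp only [inner_add_right, inner_smul_right, inner_sub_left, real_inner_smul_left]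
  ring

theorem IsStep.inner_v {s s' : State R N} (h : IsStep A b lam α μ ρ β s s')
    (d : EuclideanSpace ℝ N) :
    inner ℝ (lam - α • (s'.v - boxCenter N) + ρ • (s'.v - s.p)) d
      + inner ℝ (s.y₁ + μ • (Matrix.toEuclideanLin A s'.v + s.e₁ - b)) (Matrix.toEuclideanLin A d)
      + inner ℝ (s.y₂ + μ • (s'.v - s.e₂)) d = 0 := by
  have key : ∀ d : EuclideanSpace ℝ N,
      0 ≤ inner ℝ (lam - α • (s'.v - boxCenter N) + ρ • (s'.v - s.p)) d
      + inner ℝ (s.y₁ + μ • (Matrix.toEuclideanLin A s'.v + s.e₁ - b)) (Matrix.toEuclideanLin A d)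
      + inner ℝ (s.y₂ + μ • (s'.v - s.e₂)) d := by
    intro d
    refine nonneg_of_forall_small (Q := (ρ + μ - α) / 2 * ‖d‖ ^ 2
      + μ / 2 * ‖Matrix.toEuclideanLin A d‖ ^ 2) fun t _ _ => ?_
    have hmin := h.v_min (Set.mem_univ (s'.v + t • d))
    simp only [Set.mem_ofPred_eq, augLagrangian] at hmin
    have e1 : Matrix.toEuclideanLin A (s'.v + t • d) + s.e₁ - b
        = (Matrix.toEuclideanLin A s'.v + s.e₁ - b) + t • Matrix.toEuclideanLin A d := by
      rw [map_add, map_smul]; abel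
    have e2 : s'.v + t • d - s.e₂ = (s'.v - s.e₂) + t • d := by abel
    have e3 : s'.v + t • d - s.p = (s'.v - s.p) + t • d := by abel
    rw [e1, e2, e3, objective_add_smul] at hmin
    simp only [norm_add_smul_sq] at hmin
    rw [inner_add_right s.y₁, inner_add_right s.y₂, inner_smul_right, inner_smul_right] at hmin
    rw [inner_add_left _ (ρ • _), inner_add_left s.y₁, inner_add_left s.y₂, real_inner_smul_left,
      real_inner_smul_left, real_inner_smul_left]
    linarith
  refine le_antisymm ?_ (key d)
  have := key (-d)
  simp only [map_neg, inner_neg_right] at this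
  linarith

/-- The dual update has exactly the form of the penalty gradient, so the old multiplier and the
penalty merge into the new `y₁`. -/
theorem IsStep.inner_e₁ {s s' : State R N} (h : IsStep A b lam α μ ρ β s s')
    {e : EuclideanSpace ℝ R} (he : e ∈ orthant R) :
    0 ≤ inner ℝ (s'.y₁ + ρ • (s'.e₁ - s.z₁)) (e - s'.e₁) := by
  rw [h.y₁_eq]
  refine nonneg_of_forall_small (Q := (μ + ρ) / 2 * ‖e - s'.e₁‖ ^ 2) fun t ht ht1 => ?_
  have hmem : s'.e₁ + t • (e - s'.e₁) ∈ orthant R := fun i => by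
    have h1 := h.e₁_mem i
    have h2 := he i
    simp only [PiLp.add_apply, PiLp.smul_apply, PiLp.sub_apply, smul_eq_mul]
    nlinarith
  have hmin := h.e₁_min hmem
  simp only [Set.mem_ofPred_eq, augLagrangian] at hmin
  have e1 : Matrix.toEuclideanLin A s'.v + (s'.e₁ + t • (e - s'.e₁)) - b
      = (Matrix.toEuclideanLin A s'.v + s'.e₁ - b) + t • (e - s'.e₁) := by abel
  have e2 : s'.e₁ + t • (e - s'.e₁) - s.z₁ = (s'.e₁ - s.z₁) + t • (e - s'.e₁) := by abel
  rw [e1, e2, norm_add_smul_sq, norm_add_smul_sq, inner_add_right s.y₁, inner_smul_right] at hmin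
  rw [inner_add_left, inner_add_left, real_inner_smul_left, real_inner_smul_left]
  linarith

theorem IsStep.inner_e₂ {s s' : State R N} (h : IsStep A b lam α μ ρ β s s')
    {e : EuclideanSpace ℝ N} (he : e ∈ unitBox N) :
    0 ≤ inner ℝ (-s'.y₂ + ρ • (s'.e₂ - s.z₂)) (e - s'.e₂) := by
  rw [h.y₂_eq]
  refine nonneg_of_forall_small (Q := (μ + ρ) / 2 * ‖e - s'.e₂‖ ^ 2) fun t ht ht1 => ?_
  have hmem : s'.e₂ + t • (e - s'.e₂) ∈ unitBox N := fun i => by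
    have h1 := h.e₂_mem i
    have h2 := he i
    simp only [PiLp.add_apply, PiLp.smul_apply, PiLp.sub_apply, smul_eq_mul]
    constructor <;> nlinarith
  have hmin := h.e₂_min hmem
  simp only [Set.mem_ofPred_eq, augLagrangian] at hmin
  have e1 : s'.v - (s'.e₂ + t • (e - s'.e₂)) = (s'.v - s'.e₂) + t • -(e - s'.e₂) := by
    rw [smul_neg]; abel
  have e2 : s'.e₂ + t • (e - s'.e₂) - s.z₂ = (s'.e₂ - s.z₂) + t • (e - s'.e₂) := by abel
  rw [e1, e2, norm_add_smul_sq, norm_add_smul_sq, inner_add_right s.y₂, inner_smul_right,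
    inner_neg_right, inner_neg_right, norm_neg] at hmin
  rw [inner_add_left, inner_neg_left, inner_add_left, real_inner_smul_left, real_inner_smul_left]
  linarith

omit [DecidableEq N] in
theorem norm_le_of_mem_unitBox {v : EuclideanSpace ℝ N} (hv : v ∈ unitBox N) :
    ‖v‖ ≤ √(Fintype.card N) := by
  rw [EuclideanSpace.norm_eq]
  refine Real.sqrt_le_sqrt ?_
  calc ∑ i, ‖v i‖ ^ 2 ≤ ∑ _i : N, (1 : ℝ) := Finset.sum_le_sum fun i _ => by
        rw [Real.norm_of_nonneg (hv i).1]
        exact pow_le_one₀ (hv i).1 (hv i).2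
    _ = Fintype.card N := by simp

/-- The map `v ↦ (A v, v)`. -/
noncomputable def graphMap (A : Matrix R N ℝ) : EuclideanSpace ℝ N →L[ℝ]
    WithLp 2 (EuclideanSpace ℝ R × EuclideanSpace ℝ N) :=
  (WithLp.prodContinuousLinearEquiv 2 ℝ (EuclideanSpace ℝ R)
    (EuclideanSpace ℝ N)).symm.toContinuousLinearMap.comp
    ((Matrix.toEuclideanLin A).toContinuousLinearMap.prod (ContinuousLinearMap.id ℝ _))

/-- The normals of the constraints `a₁ ≤ b`, `a₂ ≤ 1`, `0 ≤ a₂` on pairs `(a₁, a₂)`. -/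
noncomputable def boxNormal (R N : Type*) [Fintype R] [Fintype N] [DecidableEq R] [DecidableEq N] :
    R ⊕ N ⊕ N → WithLp 2 (EuclideanSpace ℝ R × EuclideanSpace ℝ N) :=
  Sum.elim (fun i => WithLp.toLp 2 (EuclideanSpace.single i 1, 0))
    (Sum.elim (fun j => WithLp.toLp 2 (0, EuclideanSpace.single j 1))
      (fun j => WithLp.toLp 2 (0, -EuclideanSpace.single j 1)))

/-- The right-hand sides belonging to `boxNormal`. -/
def boxBound (b : EuclideanSpace ℝ R) : R ⊕ N ⊕ N → ℝ :=
  Sum.elim b (Sum.elim (fun _ => 1) (fun _ => 0))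

theorem mem_poly_boxNormal [DecidableEq R]
    (a : WithLp 2 (EuclideanSpace ℝ R × EuclideanSpace ℝ N)) :
    a ∈ poly (boxNormal R N) (boxBound b) ↔ (∀ i, a.fst i ≤ b i) ∧ a.snd ∈ unitBox N := by
  simp [boxNormal, boxBound, poly, unitBox, Sum.forall, WithLp.prod_inner_apply, forall_and,
    EuclideanSpace.inner_single_left, and_comm]

variable (A b lam) in
/-- The program `min objective` over `feasible`, with the constraints expressed through the map
`v ↦ (A v, v)`. -/
noncomputable def program [DecidableEq R] (hα : 0 < α) (hμ : 0 < μ) (hρ : α < ρ)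
    (h0 : (feasible A b).Nonempty) :
    Program (EuclideanSpace ℝ N) (WithLp 2 (EuclideanSpace ℝ R × EuclideanSpace ℝ N))
      (R ⊕ N ⊕ N) where
  K := graphMap A
  n := boxNormal R N
  c := boxBound b
  -- Expanding the square around the centre moves its linear part into `l`; the constant is dropped.
  l := lam + α • boxCenter N
  α := α
  μ := μ
  ρ := ρ
  R := √(Fintype.card N)
  α_pos := hα
  μ_pos := hμ
  α_lt_ρ := hρ
  exists_feasible := h0.imp fun v hv => (mem_poly_boxNormal (graphMap A v)).2 hv
  norm_le := fun v hv => norm_le_of_mem_unitBox ((mem_poly_boxNormal (graphMap A v)).1 hv).2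

section

variable [DecidableEq R] (hα : 0 < α) (hμ : 0 < μ) (hρ : α < ρ) (h0 : (feasible A b).Nonempty)

theorem program_K (v : EuclideanSpace ℝ N) :
    (program A b lam hα hμ hρ h0).K v = WithLp.toLp 2 (Matrix.toEuclideanLin A v, v) := rfl

theorem mem_program_C (a : WithLp 2 (EuclideanSpace ℝ R × EuclideanSpace ℝ N)) :
    a ∈ (program A b lam hα hμ hρ h0).C ↔ (∀ i, a.fst i ≤ b i) ∧ a.snd ∈ unitBox N :=
  mem_poly_boxNormal a

theorem program_grad (v : EuclideanSpace ℝ N) :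
    (program A b lam hα hμ hρ h0).grad v = lam - α • (v - boxCenter N) := by
  simp only [program, Program.grad, smul_sub]; abel

/-- The substitution `a₁ = b - e₁` turns the orthant into `a₁ ≤ b` and the equality constraint into
`A v = a₁`. The updates of `e₁` and `e₂` do not interact, so their optimality conditions add up to
that of the single block `a`. -/
theorem IsStep.program_step {s s' : State R N} (h : IsStep A b lam α μ ρ β s s') :
    (program A b lam hα hμ hρ h0).Step s.p (WithLp.toLp 2 (b - s.z₁, s.z₂))
      (WithLp.toLp 2 (b - s.e₁, s.e₂)) (WithLp.toLp 2 (s.y₁, s.y₂)) s'.v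
      (WithLp.toLp 2 (b - s'.e₁, s'.e₂)) (WithLp.toLp 2 (s'.y₁, s'.y₂)) where
  grad_eq := by
    refine ext_inner_right ℝ fun d => ?_
    rw [inner_add_left, ContinuousLinearMap.adjoint_inner_left, program_K, program_grad,
      inner_zero_left, ← h.inner_v d, WithLp.prod_inner_apply, h.y₁_eq, h.y₂_eq, add_assoc]
    refine congrArg₂ _ rfl (congrArg₂ _ (congrArg₂ _ ?_ rfl) (congrArg₂ _ ?_ rfl))
    · change s.y₁ + μ • _ + μ • (b - s'.e₁ - (b - s.e₁)) = _
      rw [add_assoc, ← smul_add]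
      congr 2
      abel
    · change s.y₂ + μ • _ + μ • (s'.e₂ - s.e₂) = _
      rw [add_assoc, ← smul_add]
      congr 2
      abel
  mem := (mem_program_C hα hμ hρ h0 _).2
    ⟨fun i => by simpa using h.e₁_mem i, h.e₂_mem⟩
  normal := by
    intro x hx
    obtain ⟨hx1, hx2⟩ := (mem_program_C hα hμ hρ h0 x).1 hx
    have h1 := h.inner_e₁ (e := b - x.fst) fun i => by simpa using hx1 i
    have h2 := h.inner_e₂ hx2
    rw [← sub_nonneg, ← inner_sub_right, WithLp.prod_inner_apply]
    change 0 ≤ inner ℝ (s'.y₁ - ρ • (b - s'.e₁ - (b - s.z₁))) (b - s'.e₁ - x.fst)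
      + inner ℝ (s'.y₂ - ρ • (s'.e₂ - s.z₂)) (s'.e₂ - x.snd)
    refine add_nonneg (h1.trans_eq ?_) (h2.trans_eq ?_)
    · congr 1
      · rw [show b - s'.e₁ - (b - s.z₁) = -(s'.e₁ - s.z₁) by abel, smul_neg, sub_neg_eq_add]
      · abel
    · rw [← inner_neg_neg]
      congr 1 <;> abel
  dual_eq := by
    rw [h.y₁_eq, h.y₂_eq, program_K]
    refine congrArg (WithLp.toLp 2) (Prod.ext ?_ rfl)
    change _ = s.y₁ + μ • (Matrix.toEuclideanLin A s'.v - (b - s'.e₁))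
    rw [sub_sub_eq_add_sub]

end

/-- Convergence of the proximal ADMM for a quadratic program over a nonempty polyhedron. -/
theorem exists_convergesTo (A : Matrix R N ℝ) (b : EuclideanSpace ℝ R)
    (lam : EuclideanSpace ℝ N) (hα : 0 < α) (hμ : 0 < μ) (hρ : α < ρ)
    (h0 : (feasible A b).Nonempty) :
    ∃ β₀ : ℝ, 0 < β₀ ∧ ∀ β : ℝ, 0 < β → β ≤ 1 → β < β₀ → ∀ s : ℕ → State R N,
      IsProxADMM A b lam α μ ρ β s →
      ∃ w : State R N, ConvergesTo s w ∧ Matrix.toEuclideanLin A w.v + w.e₁ = b ∧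
        w.v = w.e₂ ∧ w.v = w.p ∧ w.e₁ = w.z₁ ∧ w.e₂ = w.z₂ ∧
        IsStationaryPoint A b lam α w.v := by
  classical
  obtain ⟨β₀, hβ₀, h⟩ := (program A b lam hα hμ hρ h0).exists_tendsto_of_isRun
    -- The image of the all-zeros tuple: `b - e₁ = b - z₁ = b`.
    (WithLp.toLp 2 (b, 0)) 0 (WithLp.toLp 2 (b, 0)) 0
  refine ⟨β₀, hβ₀, fun β hβ hβ1 hββ₀ s hs => ?_⟩
  obtain ⟨v, y, hv, hp, ha, hy, hζ, hC, hstat⟩ := h β hβ hβ1 hββ₀ (fun k => (s k).v)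
    (fun k => (s k).p) (fun k => WithLp.toLp 2 (b - (s k).e₁, (s k).e₂))
    (fun k => WithLp.toLp 2 ((s k).y₁, (s k).y₂)) (fun k => WithLp.toLp 2 (b - (s k).z₁, (s k).z₂))
    { step := fun k => (hs.2 k).program_step hα hμ hρ h0
      p_eq := fun k => (hs.2 k).p_eq
      ζ_eq := fun k => by
        rw [(hs.2 k).z₁_eq, (hs.2 k).z₂_eq]
        refine congrArg (WithLp.toLp 2) (Prod.ext ?_ rfl)
        change _ = b - (s k).z₁ + β • (b - (s (k + 1)).e₁ - (b - (s k).z₁))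
        simp only [smul_sub]
        abel }
    (by simp [hs.1]) (by simp [hs.1]) (by simp [hs.1]) (by simp [hs.1])
  have hfst := (WithLp.fstL 2 ℝ (EuclideanSpace ℝ R) (EuclideanSpace ℝ N)).continuous
  have hsnd := (WithLp.sndL 2 ℝ (EuclideanSpace ℝ R) (EuclideanSpace ℝ N)).continuous
  have hmem : ∀ x, (program A b lam hα hμ hρ h0).K x ∈ (program A b lam hα hμ hρ h0).C ↔
      x ∈ feasible A b := fun x => by
    rw [mem_program_C, program_K]; rfl
  have ha1 : Tendsto (fun k => b - (s k).e₁) atTop (𝓝 (Matrix.toEuclideanLin A v)) :=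
    (hfst.tendsto _).comp ha
  have hζ1 : Tendsto (fun k => b - (s k).z₁) atTop (𝓝 (Matrix.toEuclideanLin A v)) :=
    (hfst.tendsto _).comp hζ
  refine ⟨⟨v, b - Matrix.toEuclideanLin A v, v, v, b - Matrix.toEuclideanLin A v, v, y.fst, y.snd⟩,
    ⟨hv, ?_, (hsnd.tendsto _).comp ha, hp, ?_, (hsnd.tendsto _).comp hζ,
      (hfst.tendsto _).comp hy, (hsnd.tendsto _).comp hy⟩,
    add_sub_cancel _ _, rfl, rfl, rfl, rfl, (hmem v).1 hC, fun x hx => ?_⟩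
  · simpa using (tendsto_const_nhds (x := b)).sub ha1
  · simpa using (tendsto_const_nhds (x := b)).sub hζ1
  · have := hstat x ((hmem x).2 hx)
    rw [program_grad, real_inner_comm] at this
    rw [gradient_objective]
    exact this

end Transfer

theorem CheckData.zero_mem_feasible {F : Type*} [Field F] [Fintype F] [DecidableEq F]
    [Algebra (ZMod 2) F] {q m n : ℕ} (bits : Module.Basis (Fin q) (ZMod 2) F)
    (C : CheckData F m n) : (0 : EuclideanSpace ℝ C.Col) ∈ feasible (C.A bits) C.b := by
  refine ⟨fun i => ?_, fun j => by simp⟩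
  rw [map_zero]
  rcases i with ⟨_, _, i⟩ | i
  · fin_cases i <;> simp [CheckData.b, t]
  · simp [CheckData.b]

end NonbinaryDecoder

theorem theorem1 {F : Type*} [Field F] [Fintype F] [DecidableEq F] [Algebra (ZMod 2) F]
    {q m n : ℕ} (bits : Module.Basis (Fin q) (ZMod 2) F) (C : CheckData F m n)
    (γ : Fin n × Nonzero F → ℝ) (α ρ μ L : ℝ)
    (hα : 0 < α) (hρ : α < ρ)
    (hL : α + μ + μ * specNorm (C.A bits) ^ 2 ≤ L)
    (hmin : 0 < lamMin (C.A bits))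
    (hμ_lower : α / lamMin (C.A bits) ≤ μ)
    (hμ_upper : μ ≤ ρ * (ρ - α) ^ 2 /
      (4 * specNormAI (C.A bits) ^ 2 * (ρ + L + 2) ^ 2 - (ρ - α) ^ 2)) :
    ∃ β₀ : ℝ, 0 < β₀ ∧ ∀ β : ℝ, 0 < β → β ≤ 1 → β < β₀ →
      ∀ s : ℕ → State C.Row C.Col,
        IsProxADMM (C.A bits) C.b (C.lam γ) α μ ρ β s →
        ∃ w : State C.Row C.Col, ConvergesTo s w ∧
          Matrix.toEuclideanLin (C.A bits) w.v + w.e₁ = C.b ∧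
          w.v = w.e₂ ∧ w.v = w.p ∧ w.e₁ = w.z₁ ∧ w.e₂ = w.z₂ ∧
          IsStationaryPoint (C.A bits) C.b (C.lam γ) α w.v := by
  -- The lower bound on `μ` supplies positivity of the penalty; feasibility of the zero vector
  -- supplies the nonempty feasible set.
  have hμ : 0 < μ := (div_pos hα hmin).trans_le hμ_lower
  exact exists_convergesTo (C.A bits) C.b (C.lam γ) hα hμ hρ ⟨0, C.zero_mem_feasible bits⟩
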